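/- **Notation.** Let $SO(3)=\{x\in\mathbb R^{3\times 3}: x^{T}x=e,\ \det x=1\}$ with its Borel $\sigma$-algebra, let $\omega(x)\in[0,\pi]$ be the rotation angle of $x\in SO(3)$ (so $\operatorname{tr}x=1+2\cos\omega(x)$), and let $\mathrm{dist}(x,y)=\omega(y^{-1}x)$. For a finite nonempty set of centers $\Xi\subset SO(3)$ the fill distance is $h=h(\Xi)=\max_{y\in SO(3)}\min_{\xi\in\Xi}\mathrm{dist}(\xi,y)$. Write $x\in SO(3)$ in Euler angles as $x=s_z[\varphi_1]s_x[\theta]s_z[\varphi_2]$ with $0\le\theta\le\pi$, where $s_z[t],s_x[t]$ are the rotations by the angle $t$ about the $z$- and $x$-axis. The Wigner D-functions are $D^{\ell}_{k,m}(x)=e^{-ik\varphi_1}P^{\ell}_{k,m}(\cos\theta)e^{-im\varphi_2}$ for $\ell\in\mathbb N_0$ and $-\ell\le k,m\le\ell$, where $$P^{\ell}_{k,m}(t)=\frac{(-1)^{\ell-k}i^{m-k}}{2^{\ell}(\ell-k)!}\sqrt{\frac{(\ell-k)!(\ell+m)!}{(\ell+k)!(\ell-m)!}}\,(1-t)^{-\frac{m-k}{2}}(1+t)^{-\frac{m+k}{2}}\frac{d^{\ell-m}}{dt^{\ell-m}}\Big((1-t)^{\ell-k}(1+t)^{\ell+k}\Big)$$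 (extended by continuity to $t=\pm1$). Let $\Pi_L$, the polynomials of degree at most $L$, be the complex linear span of the $D^{\ell}_{k,m}$ with $\ell\le L$ and $-\ell\le k,m\le\ell$. **Lemma.** There is a global constant $C>0$ such that the following holds for every integer $L\ge1$ and every finite nonempty set of centers $\Xi\subset SO(3)$ whose fill distance $h$ satisfies $h\le\dfrac{\pi}{CL^{2}}$. There is a measurable kernel $a:\Xi\times SO(3)\to\mathbb R$ satisfying the coefficient kernel conditions (CKCs) with radius $\rho=CL^{2}h$, precision $L$ and stability constant $K=2$: 1. (Support) $a(\xi,\alpha)=0$ whenever $\mathrm{dist}(\alpha,\xi)>\rho$; 2. (Precision) $\sum_{\xi\in\Xi}a(\xi,\alpha)p(\xi)=p(\alpha)$ for every $p\in\Pi_L$ and every $\alpha\in SO(3)$; 3. (Stability) $\sum_{\xi\in\Xi}|a(\xi,\alpha)|\le 2$ for every $\alpha\in SO(3)$. -/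

import Mathlib

open Polynomial

namespace RotationGroup

/-- The group `SO(3)` of real `3 × 3` matrices `x` with `xᵀ x = 1` and `det x = 1`. -/
abbrev SO3 : Type := Matrix.specialOrthogonalGroup (Fin 3) ℝ

/-- `SO(3)` carries its Borel σ-algebra. -/
instance : MeasurableSpace SO3 := borel SO3

instance : BorelSpace SO3 := ⟨rfl⟩

/-! ### Rotation angle, metric, fill distance -/

/-- The rotation angle `ω ∈ [0, π]` of a rotation, determined by `tr x = 1 + 2 cos ω`. -/
noncomputable def rotationAngle (x : SO3) : ℝ :=
  Real.arccos ((Matrix.trace (x : Matrix (Fin 3) (Fin 3) ℝ) - 1) / 2)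

/-- The translation invariant metric `dist(x, y) = ω(y⁻¹ x)`. -/
noncomputable def rotDist (x y : SO3) : ℝ := rotationAngle (y⁻¹ * x)

/-- The fill distance `h(Ξ) = max_y min_{ξ ∈ Ξ} dist(ξ, y)` of a finite nonempty set of centers. -/
noncomputable def fillDistance (Ξ : Finset SO3) : ℝ :=
  ⨆ y : SO3, ⨅ ξ : Ξ, rotDist ξ y

/-! ### Euler angles -/

/-- The rotation about the `z`-axis by the angle `t`. -/
noncomputable def rotZ (t : ℝ) : SO3 :=
  ⟨!![Real.cos t, -Real.sin t, 0; Real.sin t, Real.cos t, 0; 0, 0, 1], by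
    have h := Real.sin_sq_add_cos_sq t
    rw [Matrix.mem_specialOrthogonalGroup_iff, Matrix.mem_orthogonalGroup_iff]
    refine ⟨?_, ?_⟩
    · ext i j
      fin_cases i <;> fin_cases j <;>
        simp [Matrix.mul_apply, Fin.sum_univ_three] <;> linarith
    · simp [Matrix.det_fin_three]
      linarith⟩

/-- The rotation about the `x`-axis by the angle `t`. -/
noncomputable def rotX (t : ℝ) : SO3 :=
  ⟨!![1, 0, 0; 0, Real.cos t, -Real.sin t; 0, Real.sin t, Real.cos t], by
    have h := Real.sin_sq_add_cos_sq t
    rw [Matrix.mem_specialOrthogonalGroup_iff, Matrix.mem_orthogonalGroup_iff]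
    refine ⟨?_, ?_⟩
    · ext i j
      fin_cases i <;> fin_cases j <;>
        simp [Matrix.mul_apply, Fin.sum_univ_three] <;> linarith
    · simp [Matrix.det_fin_three]
      linarith⟩

/-- The rotation `s_z[φ₁] s_x[θ] s_z[φ₂]` with Euler angles `(φ₁, θ, φ₂)`. -/
noncomputable def ofEuler (φ₁ θ φ₂ : ℝ) : SO3 := rotZ φ₁ * rotX θ * rotZ φ₂

/-- The second Euler angle `θ ∈ [0, π]`. -/
noncomputable def eulerTheta (x : SO3) : ℝ := Real.arccos (x.1 2 2)

open Classical in
/-- A first Euler angle `φ₁`, modulo `2π`. In the degenerate case `sin θ = 0`, where the Euler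
angles are not unique, `φ₂ = 0` is chosen. -/
noncomputable def eulerPhi₁ (x : SO3) : ℝ :=
  if x.1 0 2 = 0 ∧ x.1 1 2 = 0 then Complex.arg ⟨x.1 0 0, x.1 1 0⟩
  else Complex.arg ⟨-x.1 1 2, x.1 0 2⟩

/-- A third Euler angle `φ₂`, modulo `2π`. -/
noncomputable def eulerPhi₂ (x : SO3) : ℝ := Complex.arg ⟨x.1 2 1, x.1 2 0⟩

/-! ### Wigner D-functions and polynomials on `SO(3)` -/

/-- The constant
`(-1)^(ℓ-k) i^(m-k) / (2^ℓ (ℓ-k)!) * √((ℓ-k)! (ℓ+m)! / ((ℓ+k)! (ℓ-m)!))`, for `|k|, |m| ≤ ℓ`. -/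
noncomputable def wignerConst (ℓ : ℕ) (k m : ℤ) : ℂ :=
  ((-1) ^ (ℓ - k) * Complex.I ^ (m - k) / (2 ^ ℓ * ((ℓ - k).toNat.factorial : ℂ))) *
    (Real.sqrt (((ℓ - k).toNat.factorial * (ℓ + m).toNat.factorial : ℝ) /
      ((ℓ + k).toNat.factorial * (ℓ - m).toNat.factorial)) : ℂ)

/-- The function
`P^ℓ_{k,m}(t) = C (1-t)^(-(m-k)/2) (1+t)^(-(m+k)/2) (d/dt)^(ℓ-m) ((1-t)^(ℓ-k) (1+t)^(ℓ+k))`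
on `[-1, 1]`, for `|k|, |m| ≤ ℓ`. At an endpoint `t = ±1` it takes its limit value: if one of the
two real exponents is nonzero and its base vanishes, then that limit is `0`, in accordance with the
convention `0 ^ s = 0` for `s ≠ 0`. -/
noncomputable def wignerP (ℓ : ℕ) (k m : ℤ) (t : ℝ) : ℂ :=
  wignerConst ℓ k m *
    (((1 - t) ^ (-((m : ℝ) - k) / 2) * (1 + t) ^ (-((m : ℝ) + k) / 2) *
      (derivative^[(ℓ - m).toNat]
        ((1 - X) ^ (ℓ - k).toNat * (1 + X) ^ (ℓ + k).toNat : ℝ[X])).eval t : ℝ) : ℂ)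

/-- The right-hand side `e^(-i k φ₁) P^ℓ_{k,m}(cos θ) e^(-i m φ₂)` in terms of Euler angles. -/
noncomputable def wignerDEuler (ℓ : ℕ) (k m : ℤ) (φ₁ θ φ₂ : ℝ) : ℂ :=
  Complex.exp (-Complex.I * k * φ₁) * wignerP ℓ k m (Real.cos θ) *
    Complex.exp (-Complex.I * m * φ₂)

/-- The Wigner D-function `D^ℓ_{k,m}` on `SO(3)`. By `wignerD_ofEuler` its value does not depend on
the choice of the Euler angles. -/
noncomputable def wignerD (ℓ : ℕ) (k m : ℤ) (x : SO3) : ℂ :=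
  wignerDEuler ℓ k m (eulerPhi₁ x) (eulerTheta x) (eulerPhi₂ x)

/-- The space `Π_L` of polynomials of degree at most `L` on `SO(3)`: the complex span of the
Wigner D-functions `D^ℓ_{k,m}` with `ℓ ≤ L` and `-ℓ ≤ k, m ≤ ℓ`. -/
noncomputable def polynomialSpace (L : ℕ) : Submodule ℂ (SO3 → ℂ) :=
  Submodule.span ℂ {f | ∃ (ℓ : ℕ) (k m : ℤ), ℓ ≤ L ∧ |k| ≤ ℓ ∧ |m| ≤ ℓ ∧ f = wignerD ℓ k m}

/-! ### Coefficient kernel conditions -/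

/-- The kernel `a : Ξ × SO(3) → ℝ` is measurable and satisfies the coefficient kernel conditions
with radius `ρ`, precision `L` and stability constant `K`. -/
structure CoefficientKernelConditions (Ξ : Finset SO3) (ρ : ℝ) (L : ℕ) (K : ℝ)
    (a : Ξ × SO3 → ℝ) : Prop where
  measurable : Measurable a
  support : ∀ (ξ : Ξ) (α : SO3), ρ < rotDist α ξ → a (ξ, α) = 0
  precision : ∀ p ∈ polynomialSpace L, ∀ α : SO3, ∑ ξ : Ξ, (a (ξ, α) : ℂ) * p ξ = p α
  one_le : 1 ≤ K
  stability : ∀ α : SO3, ∑ ξ : Ξ, |a (ξ, α)| ≤ K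

/-! ### The definitions do not depend on choices -/

theorem coe_ofEuler (φ₁ θ φ₂ : ℝ) :
    (ofEuler φ₁ θ φ₂).1 =
      !![Real.cos φ₁ * Real.cos φ₂ - Real.sin φ₁ * Real.cos θ * Real.sin φ₂,
          -(Real.cos φ₁ * Real.sin φ₂) - Real.sin φ₁ * Real.cos θ * Real.cos φ₂,
          Real.sin φ₁ * Real.sin θ;
        Real.sin φ₁ * Real.cos φ₂ + Real.cos φ₁ * Real.cos θ * Real.sin φ₂,
          -(Real.sin φ₁ * Real.sin φ₂) + Real.cos φ₁ * Real.cos θ * Real.cos φ₂,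
          -(Real.cos φ₁ * Real.sin θ);
        Real.sin θ * Real.sin φ₂, Real.sin θ * Real.cos φ₂, Real.cos θ] := by
  ext i j
  fin_cases i <;> fin_cases j <;>
    simp [ofEuler, rotZ, rotX] <;> ring

/-- The rotations by the angle `t ∈ [0, π]` about any axis are the conjugates of `s_z[t]`; their
rotation angle is `t`. -/
theorem rotationAngle_conj_rotZ (y : SO3) {t : ℝ} (h0 : 0 ≤ t) (h1 : t ≤ Real.pi) :
    rotationAngle (y * rotZ t * y⁻¹) = t := by
  have h : Matrix.trace ((y * rotZ t * y⁻¹ : SO3) : Matrix (Fin 3) (Fin 3) ℝ)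
      = Matrix.trace ((rotZ t : SO3) : Matrix (Fin 3) (Fin 3) ℝ) := by
    have e : (y⁻¹ * (y * rotZ t) : SO3) = rotZ t := by group
    calc Matrix.trace ((y * rotZ t * y⁻¹ : SO3) : Matrix (Fin 3) (Fin 3) ℝ)
        = Matrix.trace ((y⁻¹ * (y * rotZ t) : SO3) : Matrix (Fin 3) (Fin 3) ℝ) := by
          rw [Submonoid.coe_mul, Matrix.trace_mul_comm, ← Submonoid.coe_mul]
      _ = _ := by rw [e]
  rw [rotationAngle, h]
  have : (Matrix.trace ((rotZ t : SO3) : Matrix (Fin 3) (Fin 3) ℝ) - 1) / 2 = Real.cos t := by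
    simp [rotZ, Matrix.trace, Fin.sum_univ_three]
  rw [this, Real.arccos_cos h0 h1]

theorem exp_neg_arg_of_pos {r : ℝ} (hr : 0 < r) (k : ℤ) (φ : ℝ) (z : ℂ)
    (hz : z = r * Complex.exp (φ * Complex.I)) :
    Complex.exp (-Complex.I * k * z.arg) = Complex.exp (-Complex.I * k * φ) := by
  have h1 : ‖z‖ = r := by
    rw [hz, norm_mul, Complex.norm_exp_ofReal_mul_I, Complex.norm_real, Real.norm_eq_abs,
      abs_of_pos hr, mul_one]
  have h2 : Complex.exp (z.arg * Complex.I) = Complex.exp (φ * Complex.I) := by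
    have h := Complex.norm_mul_exp_arg_mul_I z
    rw [h1] at h
    have hr' : (r : ℂ) ≠ 0 := by exact_mod_cast hr.ne'
    exact mul_left_cancel₀ hr' (h.trans hz)
  have h3 : ∀ s : ℝ, Complex.exp (-Complex.I * k * s) = Complex.exp (s * Complex.I) ^ (-k) := by
    intro s
    rw [← Complex.exp_int_mul]
    congr 1
    push_cast
    ring
  rw [h3, h3, h2]

theorem wignerP_one {ℓ : ℕ} {k m : ℤ} (h : k ≠ m) : wignerP ℓ k m 1 = 0 := by
  have : -((m : ℝ) - k) / 2 ≠ 0 := by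
    intro h'
    apply h
    have : (k : ℝ) = m := by linarith
    exact_mod_cast this
  rw [wignerP, sub_self, Real.zero_rpow this]
  simp

theorem wignerP_neg_one {ℓ : ℕ} {k m : ℤ} (h : k ≠ -m) : wignerP ℓ k m (-1) = 0 := by
  have : -((m : ℝ) + k) / 2 ≠ 0 := by
    intro h'
    apply h
    have : (k : ℝ) = -m := by linarith
    exact_mod_cast this
  rw [wignerP, add_neg_cancel, Real.zero_rpow this]
  simp

/-- The Wigner D-function is given by its formula in whatever Euler angles. -/
theorem wignerD_ofEuler (ℓ : ℕ) (k m : ℤ) (φ₁ φ₂ : ℝ) {θ : ℝ} (h0 : 0 ≤ θ) (h1 : θ ≤ Real.pi) :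
    wignerD ℓ k m (ofEuler φ₁ θ φ₂) = wignerDEuler ℓ k m φ₁ θ φ₂ := by
  have hθ : eulerTheta (ofEuler φ₁ θ φ₂) = θ := by
    simp [eulerTheta, coe_ofEuler, Real.arccos_cos h0 h1]
  have hs := Real.sin_sq_add_cos_sq φ₁
  rw [wignerD, hθ]
  unfold wignerDEuler
  rcases (Real.sin_nonneg_of_nonneg_of_le_pi h0 h1).eq_or_lt with h | h
  · have hφ₂ : eulerPhi₂ (ofEuler φ₁ θ φ₂) = 0 := by
      have h00 : (⟨0, 0⟩ : ℂ) = 0 := rfl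
      simp [eulerPhi₂, coe_ofEuler, ← h, h00]
    have hφ₁ : eulerPhi₁ (ofEuler φ₁ θ φ₂) = Complex.arg
        ⟨Real.cos φ₁ * Real.cos φ₂ - Real.sin φ₁ * Real.cos θ * Real.sin φ₂,
          Real.sin φ₁ * Real.cos φ₂ + Real.cos φ₁ * Real.cos θ * Real.sin φ₂⟩ := by
      simp [eulerPhi₁, coe_ofEuler, ← h]
    rw [hφ₂, hφ₁]
    have hc : Real.cos θ = 1 ∨ Real.cos θ = -1 := by
      have := Real.sin_sq_add_cos_sq θ
      rw [← h] at this
      have h2 : (Real.cos θ - 1) * (Real.cos θ + 1) = 0 := by linarith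
      rcases mul_eq_zero.mp h2 with h3 | h3
      · left; linarith
      · right; linarith
    rcases hc with hc | hc
    · rw [hc]
      by_cases hkm : k = m
      · subst hkm
        rw [exp_neg_arg_of_pos one_pos k (φ₁ + φ₂)]
        · have : Complex.exp (-Complex.I * k * ((φ₁ + φ₂ : ℝ) : ℂ)) =
              Complex.exp (-Complex.I * k * φ₁) * Complex.exp (-Complex.I * k * φ₂) := by
            rw [← Complex.exp_add]
            congr 1
            push_cast
            ring
          rw [this]
          simp
          ring
        · apply Complex.ext <;>
            simp [Complex.exp_ofReal_mul_I_re, Complex.exp_ofReal_mul_I_im, -Complex.ofReal_add,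
              Real.cos_add, Real.sin_add]
      · simp [wignerP_one hkm]
    · rw [hc]
      by_cases hkm : k = -m
      · subst hkm
        rw [exp_neg_arg_of_pos one_pos (-m) (φ₁ - φ₂)]
        · have : Complex.exp (-Complex.I * (-m : ℤ) * ((φ₁ - φ₂ : ℝ) : ℂ)) =
              Complex.exp (-Complex.I * (-m : ℤ) * φ₁) * Complex.exp (-Complex.I * m * φ₂) := by
            rw [← Complex.exp_add]
            congr 1
            push_cast
            ring
          rw [this]
          simp
          ring
        · apply Complex.ext <;>
            simp [Complex.exp_ofReal_mul_I_re, Complex.exp_ofReal_mul_I_im, -Complex.ofReal_sub,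
              Real.cos_sub, Real.sin_sub]
          ring
      · simp [wignerP_neg_one hkm]
  · have hne : ¬ ((ofEuler φ₁ θ φ₂).1 0 2 = 0 ∧ (ofEuler φ₁ θ φ₂).1 1 2 = 0) := by
      rintro ⟨ha, hb⟩
      simp [coe_ofEuler, h.ne'] at ha hb
      rw [ha, hb] at hs
      norm_num at hs
    rw [eulerPhi₁, if_neg hne, eulerPhi₂, exp_neg_arg_of_pos h k φ₁, exp_neg_arg_of_pos h m φ₂]
    · apply Complex.ext <;>
        simp [coe_ofEuler, Complex.exp_ofReal_mul_I_re, Complex.exp_ofReal_mul_I_im,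
          -Complex.ofReal_sin, -Complex.ofReal_cos]
    · apply Complex.ext <;>
        simp [coe_ofEuler, Complex.exp_ofReal_mul_I_re, Complex.exp_ofReal_mul_I_im,
          -Complex.ofReal_sin, -Complex.ofReal_cos] <;> ring

/-- For all `p, q` there are a nonnegative `r` and an angle `t` with `p = r cos t`,
`q = r sin t`. -/
theorem exists_polar (p q : ℝ) : ∃ r t : ℝ, 0 ≤ r ∧ p = r * Real.cos t ∧ q = r * Real.sin t :=
  ⟨‖(⟨p, q⟩ : ℂ)‖, Complex.arg ⟨p, q⟩, norm_nonneg _,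
    (Complex.norm_mul_cos_arg ⟨p, q⟩).symm, (Complex.norm_mul_sin_arg ⟨p, q⟩).symm⟩

theorem rotZ_add (s t : ℝ) : rotZ (s + t) = rotZ s * rotZ t := by
  apply Subtype.ext
  ext i j
  fin_cases i <;> fin_cases j <;> simp [rotZ, Real.sin_add, Real.cos_add] <;> ring

theorem rotZ_zero : rotZ 0 = 1 := by
  apply Subtype.ext
  ext i j
  fin_cases i <;> fin_cases j <;> simp [rotZ]

/-- A rotation with `x 0 2 = 0` and `x 2 0 = 0` is, entrywise, of the form `s_z[t] s_x[θ]`. -/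
theorem exists_entries {a b d e r r' z : ℝ} (hr : 0 ≤ r) (hr' : 0 ≤ r')
    (c00 : a * a + d * d = 1) (c01 : a * b + d * e = 0) (c02 : d * r = 0)
    (c12 : -(e * r) + r' * z = 0) (c22 : r * r + z * z = 1) (r02 : b * r' = 0)
    (r22 : r' * r' + z * z = 1) (hdet : a * (e * z + r * r') - b * d * z = 1) :
    r' = r ∧ -1 ≤ z ∧ z ≤ 1 ∧ ∃ t : ℝ, a = Real.cos t ∧ d = Real.sin t ∧
      b = -(Real.sin t * z) ∧ e = Real.cos t * z ∧ Real.sin t * r = 0 ∧ Real.cos t * r = r := by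
  have hrr : r' = r := by nlinarith
  subst hrr
  refine ⟨rfl, by nlinarith, by nlinarith, ?_⟩
  rcases hr.eq_or_lt with h | h
  · subst h
    obtain ⟨u, t, hu, hat, hdt⟩ := exists_polar a d
    have st := Real.sin_sq_add_cos_sq t
    have hu1 : u = 1 := by
      rw [hat, hdt] at c00
      have : u ^ 2 = 1 := by linear_combination c00 - u ^ 2 * st
      nlinarith
    rw [hu1, one_mul] at hat hdt
    subst hat hdt
    refine ⟨t, rfl, rfl, ?_, ?_, by simp, by simp⟩
    · linear_combination Real.cos t * c01 - b * st - Real.sin t * z * hdet +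
        (Real.sin t * Real.cos t * e - Real.sin t ^ 2 * b) * c22
    · linear_combination Real.sin t * c01 - e * st + Real.cos t * z * hdet -
        (Real.cos t ^ 2 * e - Real.sin t * Real.cos t * b) * c22
  · have hd : d = 0 := (mul_eq_zero.mp c02).resolve_right h.ne'
    have hb : b = 0 := (mul_eq_zero.mp r02).resolve_right h.ne'
    have he : e = z := by
      have : r' * (e - z) = 0 := by linarith
      have := (mul_eq_zero.mp this).resolve_left h.ne'
      linarith
    subst hd hb he
    have ha : a = 1 := by linear_combination hdet - a * c22
    exact ⟨0, by simp [ha], by simp, by simp, by simp, by simp, by simp⟩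

/-- The orthogonality relations of rows and columns of a rotation, entrywise. -/
theorem entry_relations (y : SO3) :
    (∀ i j, y.1 0 i * y.1 0 j + y.1 1 i * y.1 1 j + y.1 2 i * y.1 2 j = if i = j then 1 else 0) ∧
    (∀ i j, y.1 i 0 * y.1 j 0 + y.1 i 1 * y.1 j 1 + y.1 i 2 * y.1 j 2 = if i = j then 1 else 0) ∧
    y.1.det = 1 := by
  have hy := Matrix.mem_specialOrthogonalGroup_iff.mp y.2
  refine ⟨fun i j => ?_, fun i j => ?_, hy.2⟩
  · have h := congrFun (congrFun ((Matrix.mem_orthogonalGroup_iff' _ _).mp hy.1) i) j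
    simpa [Matrix.mul_apply, Fin.sum_univ_three, Matrix.one_apply, Matrix.star_apply] using h
  · have h := congrFun (congrFun ((Matrix.mem_orthogonalGroup_iff _ _).mp hy.1) i) j
    simpa [Matrix.mul_apply, Fin.sum_univ_three, Matrix.one_apply, Matrix.star_apply] using h

/-- Every rotation has Euler angles. -/
theorem exists_ofEuler (x : SO3) :
    ∃ φ₁ θ φ₂ : ℝ, 0 ≤ θ ∧ θ ≤ Real.pi ∧ x = ofEuler φ₁ θ φ₂ := by
  obtain ⟨r, φ₁, hr, hp, hq⟩ := exists_polar (-x.1 1 2) (x.1 0 2)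
  obtain ⟨r', φ₂, hr', hp', hq'⟩ := exists_polar (x.1 2 1) (x.1 2 0)
  obtain ⟨y, hy⟩ : ∃ y : SO3, y = rotZ (-φ₁) * x * rotZ (-φ₂) := ⟨_, rfl⟩
  have hxy : x = rotZ φ₁ * y * rotZ φ₂ := by
    have e1 : rotZ φ₁ * rotZ (-φ₁) = 1 := by rw [← rotZ_add, add_neg_cancel, rotZ_zero]
    have e2 : rotZ (-φ₂) * rotZ φ₂ = 1 := by rw [← rotZ_add, neg_add_cancel, rotZ_zero]
    rw [hy]
    calc x = (rotZ φ₁ * rotZ (-φ₁)) * x * (rotZ (-φ₂) * rotZ φ₂) := by rw [e1, e2]; simp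
      _ = _ := by simp only [mul_assoc]
  have s1 := Real.sin_sq_add_cos_sq φ₁
  have s2 := Real.sin_sq_add_cos_sq φ₂
  have hp : x.1 1 2 = -(r * Real.cos φ₁) := by linarith
  have h02 : y.1 0 2 = 0 := by
    simp [hy, rotZ, Matrix.vecMul, Matrix.mul_apply, dotProduct, Fin.sum_univ_three, hp, hq]
    ring
  have h12 : y.1 1 2 = -r := by
    simp [hy, rotZ, Matrix.vecMul, Matrix.mul_apply, dotProduct, Fin.sum_univ_three, hp, hq]
    linear_combination (-r) * s1
  have h20 : y.1 2 0 = 0 := by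
    simp [hy, rotZ, Matrix.vecMul, Matrix.mul_apply, dotProduct, Fin.sum_univ_three, hp', hq']
    ring
  have h21 : y.1 2 1 = r' := by
    simp [hy, rotZ, Matrix.vecMul, Matrix.mul_apply, dotProduct, Fin.sum_univ_three, hp', hq']
    linear_combination r' * s2
  obtain ⟨hc, hrow, hdet⟩ := entry_relations y
  have c22 := hc 2 2
  have r22 := hrow 2 2
  have c00 := hc 0 0
  have c01 := hc 0 1
  have c02 := hc 0 2
  have c12 := hc 1 2
  have r02 := hrow 0 2
  rw [Matrix.det_fin_three] at hdet
  rw [if_pos rfl] at c22 r22 c00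
  rw [if_neg (by decide)] at c01 c02 c12 r02
  rw [h02, h12, h20, h21] at hdet
  rw [h02, h12] at c22
  rw [h20, h21] at r22
  rw [h20] at c00
  rw [h20, h21] at c01
  rw [h02, h12, h20] at c02
  rw [h02, h12, h21] at c12
  rw [h02, h20, h21] at r02
  obtain ⟨hrr, hz1, hz2, t, ha, hd, hb, he, hsr, hcr⟩ :=
    exists_entries (a := y.1 0 0) (b := y.1 0 1) (d := y.1 1 0) (e := y.1 1 1) (z := y.1 2 2)
      hr hr' (by linarith) (by linarith) (by linarith) (by linarith) (by linarith) (by linarith)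
      (by linarith) (by linear_combination hdet)
  have hcos : Real.cos (Real.arccos (y.1 2 2)) = y.1 2 2 := Real.cos_arccos hz1 hz2
  have hsin : Real.sin (Real.arccos (y.1 2 2)) = r := by
    rw [Real.sin_arccos, show 1 - y.1 2 2 ^ 2 = r ^ 2 by linear_combination -c22, Real.sqrt_sq hr]
  have ht : y = rotZ t * rotX (Real.arccos (y.1 2 2)) := by
    apply Subtype.ext
    ext i j
    fin_cases i <;> fin_cases j <;>
      simp [rotZ, rotX, hcos, hsin, h02, h12, h20, h21, ha, hd, hb, he, hrr] <;>
      first | exact mul_eq_zero.mp hsr | linarith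
  refine ⟨φ₁ + t, Real.arccos (y.1 2 2), φ₂, Real.arccos_nonneg _, Real.arccos_le_pi _, ?_⟩
  rw [ofEuler, rotZ_add, mul_assoc (rotZ φ₁), ← ht]
  exact hxy

end RotationGroup

/-! ### Markov's inequality for algebraic polynomials -/

/-! By duality, coefficients at a point `α` exist once the centers within `ρ` of `α` are norming:
|Re p(α)| ≤ 2 max |Re p(ξ)| for all p in Π_L. Hahn–Banach in the sup norm on ℝ^Ξ then represents Re
p(α) by weights of ℓ¹-norm at most 2 (`exists_coeff_of_abs_le`). Real parts suffice because Π_L is a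
complex space.

The norming inequality is proved on the unit sphere of quaternions, which covers SO(3). There D^ℓ
becomes a homogeneous polynomial of degree 2ℓ. Hence along a great circle, with y = sin t and c =
cos t, an element of Π_L has the form A(y) + c B(y), with algebraic A, B of degree at most 2L and
opposite parities. On a short arc |y| ≤ m the parities bound A and B separately by the maximum on
the arc, and Markov's inequality bounds the variation by a multiple of L²/m times that maximum.

Let β maximize |Re p| on a cap of radius comparable to `ρ` around `α`. If some center ξ at distance
O(h) from β lies on an arc that starts at β, stays in the cap and has length comparable to `ρ`, then
Re p changes between β and ξ by at most O(L² h/ρ) times the maximum, hence by at most half of it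
when ρ = C L² h. Such a ξ exists even if β is on the boundary of the cap: start from β towards a
point z well inside, take a center near the beginning of this path, and prolong the arc from β
through that center; it ends near z (`IsArcPoly.exists_abs_le_two_mul`).

For measurability, the admissible pairs (α, a) form a closed set with nonempty convex slices, and
the element of minimal Euclidean norm depends measurably on α. -/

theorem Polynomial.eval_derivative_le_of_abs_le {n : ℕ} {P : ℝ[X]} (hP : P.degree ≤ n)
    {u v M : ℝ} (huv : u < v) (hM : 0 < M) (h : ∀ x ∈ Set.Icc u v, |P.eval x| ≤ M) :
    P.derivative.eval v ≤ 2 * n ^ 2 / (v - u) * M := by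
  set l : ℝ[X] := C ((v - u) / 2) * X + C ((u + v) / 2) with hl
  have hle : ∀ x, l.eval x = (v - u) / 2 * x + (u + v) / 2 := fun x => by simp [hl]
  have hd : (C M⁻¹ * P.comp l).degree ≤ n := by
    refine natDegree_le_iff_degree_le.mp ((natDegree_C_mul_le _ _).trans ?_)
    refine natDegree_comp_le.trans ?_
    calc P.natDegree * l.natDegree ≤ n * 1 :=
          Nat.mul_le_mul (natDegree_le_iff_degree_le.mpr hP) natDegree_linear_le
      _ = n := mul_one n
  -- Among polynomials bounded by 1 on [-1, 1], the Chebyshev polynomial has the largest derivative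
  -- at 1, namely n².
  have key := Chebyshev.eval_iterate_derivative_le_of_forall_abs_le_one (k := 1) le_rfl hd ?_
  · have h1 : l.eval 1 = v := by rw [hle]; ring
    simp only [Function.iterate_one, derivative_mul, derivative_C, derivative_comp, eval_mul,
      eval_comp, eval_C, h1, zero_mul, zero_add,
      Chebyshev.derivative_T_eval_one] at key
    have h2 : (derivative l).eval 1 = (v - u) / 2 := by simp [hl]
    rw [h2] at key
    have : 0 < v - u := sub_pos.mpr huv
    have e : (derivative P).eval v = (M⁻¹ * ((v - u) / 2 * (derivative P).eval v)) *
        (2 / (v - u) * M) := by field_simp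
    rw [e]
    calc _ ≤ ((n : ℤ) : ℝ) ^ 2 * (2 / (v - u) * M) := by gcongr
      _ = _ := by push_cast; ring
  · intro x hx
    have hv : l.eval x ∈ Set.Icc u v := by
      rw [hle]
      constructor <;> nlinarith [hx.1, hx.2]
    rw [eval_mul, eval_C, eval_comp, abs_mul, abs_of_pos (inv_pos.mpr hM), inv_mul_le_iff₀ hM,
      mul_one]
    exact h _ hv

theorem Polynomial.abs_eval_derivative_right_le {n : ℕ} {P : ℝ[X]} (hP : P.degree ≤ n)
    {u v M : ℝ} (huv : u < v) (hM : 0 < M) (h : ∀ x ∈ Set.Icc u v, |P.eval x| ≤ M) :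
    |P.derivative.eval v| ≤ 2 * n ^ 2 / (v - u) * M := by
  rw [abs_le']
  refine ⟨eval_derivative_le_of_abs_le hP huv hM h, ?_⟩
  simpa using eval_derivative_le_of_abs_le (P := -P) (by simpa using hP) huv hM (by simpa using h)

theorem Polynomial.abs_eval_derivative_left_le {n : ℕ} {P : ℝ[X]} (hP : P.degree ≤ n)
    {u v M : ℝ} (huv : u < v) (hM : 0 < M) (h : ∀ x ∈ Set.Icc u v, |P.eval x| ≤ M) :
    |P.derivative.eval u| ≤ 2 * n ^ 2 / (v - u) * M := by
  have hd : (P.comp (-X)).degree ≤ n := by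
    refine natDegree_le_iff_degree_le.mp (natDegree_comp_le.trans ?_)
    simpa using natDegree_le_iff_degree_le.mpr hP
  have := abs_eval_derivative_right_le hd (neg_lt_neg huv) hM (fun x hx => by
    simpa using h (-x) ⟨by linarith [hx.2], by linarith [hx.1]⟩)
  simpa [derivative_comp, neg_add_eq_sub] using this

/-- **Markov's inequality**, up to a factor two. -/
theorem Polynomial.abs_eval_derivative_le {n : ℕ} {P : ℝ[X]} (hP : P.degree ≤ n)
    {m M : ℝ} (hm : 0 < m) (hM : 0 < M) (h : ∀ x ∈ Set.Icc (-m) m, |P.eval x| ≤ M)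
    {x : ℝ} (hx : x ∈ Set.Icc (-m) m) :
    |P.derivative.eval x| ≤ 2 * n ^ 2 / m * M := by
  -- The point x cuts [-m, m] in two; the longer piece has length at least m and has x as an
  -- endpoint, so the endpoint estimate applies there.
  rcases le_total 0 x with h0 | h0
  · refine (abs_eval_derivative_right_le hP (u := -m) (by linarith) hM
      fun y hy => h y ⟨hy.1, hy.2.trans hx.2⟩).trans ?_
    gcongr
    linarith
  · refine (abs_eval_derivative_left_le hP (v := m) (by linarith) hM
      fun y hy => h y ⟨hx.1.trans hy.1, hy.2⟩).trans ?_
    gcongr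
    linarith

theorem Polynomial.abs_eval_sub_eval_le {n : ℕ} {P : ℝ[X]} (hP : P.degree ≤ n)
    {m M : ℝ} (hm : 0 < m) (hM : 0 < M) (h : ∀ x ∈ Set.Icc (-m) m, |P.eval x| ≤ M)
    {x y : ℝ} (hx : x ∈ Set.Icc (-m) m) (hy : y ∈ Set.Icc (-m) m) :
    |P.eval y - P.eval x| ≤ 2 * n ^ 2 / m * M * |y - x| :=
  (convex_Icc (-m) m).norm_image_sub_le_of_norm_deriv_le (f := fun t => P.eval t)
    (fun _ _ => P.differentiableAt) (fun t ht => by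
      rw [Polynomial.deriv, Real.norm_eq_abs]
      exact abs_eval_derivative_le hP hm hM h ht) hx hy

/-! ### Markov's inequality on arcs -/

/-- A function `A(sin t) + cos t * B(sin t)` which is bounded by `M` on a short arc
`|sin t| ≤ m`, where `A`, `B` have opposite parities, varies slowly on that arc. -/
theorem abs_arc_sub_le {n : ℕ} (hn : 1 ≤ n) {A B : ℝ[X]} (hA : A.degree ≤ n) (hB : B.degree ≤ n)
    {m M D : ℝ} (hm : 0 < m) (hm' : m ≤ 1 / 2) (hM : 0 < M)
    (h₁ : ∀ c y : ℝ, 0 ≤ c → |y| ≤ m → c ^ 2 + y ^ 2 = 1 → |A.eval y + c * B.eval y| ≤ M)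
    (h₂ : ∀ c y : ℝ, 0 ≤ c → |y| ≤ m → c ^ 2 + y ^ 2 = 1 → |A.eval y - c * B.eval y| ≤ M)
    {c₀ y₀ c₁ y₁ : ℝ} (hy₀ : |y₀| ≤ m) (hy₁ : |y₁| ≤ m)
    (e₁ : c₁ ^ 2 + y₁ ^ 2 = 1) (hc : |c₁ - c₀| ≤ D)
    (hy : |y₁ - y₀| ≤ D) :
    |(A.eval y₁ + c₁ * B.eval y₁) - (A.eval y₀ + c₀ * B.eval y₀)| ≤ 7 * n ^ 2 / m * M * D := by
  -- Half the sum and half the difference of the quantities in `h₁` and `h₂` are A and cB; since |y|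
  -- ≤ 1/2 forces c ≥ 1/2, dividing by c costs a factor of at most two.
  have hAB : ∀ y ∈ Set.Icc (-m) m, |A.eval y| ≤ M ∧ |B.eval y| ≤ 2 * M := by
    intro y hy
    have hym : |y| ≤ m := abs_le.mpr hy
    have hy2 : y ^ 2 ≤ 1 / 4 := by
      rw [← sq_abs]; nlinarith [abs_nonneg y]
    have hs : √(1 - y ^ 2) ^ 2 + y ^ 2 = 1 := by rw [Real.sq_sqrt (by linarith)]; ring
    have hs2 : 1 / 2 ≤ √(1 - y ^ 2) := Real.le_sqrt_of_sq_le (by linarith)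
    have a₁ := abs_le.mp (h₁ _ y (Real.sqrt_nonneg _) hym hs)
    have a₂ := abs_le.mp (h₂ _ y (Real.sqrt_nonneg _) hym hs)
    refine ⟨abs_le.mpr ⟨by linarith, by linarith⟩, ?_⟩
    have : |√(1 - y ^ 2) * B.eval y| ≤ M := abs_le.mpr ⟨by linarith, by linarith⟩
    rw [abs_mul, abs_of_nonneg (Real.sqrt_nonneg _)] at this
    nlinarith [abs_nonneg (B.eval y)]
  have hy₀' := abs_le.mp hy₀
  have hy₁' := abs_le.mp hy₁
  have dA := Polynomial.abs_eval_sub_eval_le hA hm hM (fun y hy => (hAB y hy).1) hy₀' hy₁'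
  have dB := Polynomial.abs_eval_sub_eval_le hB hm (by linarith : 0 < 2 * M)
    (fun y hy => (hAB y hy).2) hy₀' hy₁'
  have hB₀ := (hAB y₀ hy₀').2
  have hc1 : |c₁| ≤ 1 := abs_le_one_iff_mul_self_le_one.mpr (by nlinarith)
  have hD : 0 ≤ D := (abs_nonneg _).trans hy
  have hnm : 0 ≤ 2 * (n : ℝ) ^ 2 / m := by positivity
  -- This absorbs the term from the change of c, so that the constant is 2 + 4 + 1 = 7.
  have hone : 2 ≤ (n : ℝ) ^ 2 / m := by
    rw [le_div_iff₀ hm]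
    have : (1 : ℝ) ≤ n := by exact_mod_cast hn
    nlinarith
  calc |(A.eval y₁ + c₁ * B.eval y₁) - (A.eval y₀ + c₀ * B.eval y₀)|
      = |(A.eval y₁ - A.eval y₀) + c₁ * (B.eval y₁ - B.eval y₀) + (c₁ - c₀) * B.eval y₀| := by
        congr 1; ring
    _ ≤ |A.eval y₁ - A.eval y₀| + |c₁| * |B.eval y₁ - B.eval y₀| + |c₁ - c₀| * |B.eval y₀| := by
        rw [← abs_mul, ← abs_mul]; exact abs_add_three _ _ _
    _ ≤ 2 * n ^ 2 / m * M * D + 1 * (2 * n ^ 2 / m * (2 * M) * D) + D * (2 * M) := by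
        gcongr
        · exact dA.trans (by gcongr)
        · exact dB.trans (by gcongr)
    _ ≤ 2 * n ^ 2 / m * M * D + 1 * (2 * n ^ 2 / m * (2 * M) * D) + D * (n ^ 2 / m * M) := by
        gcongr
    _ = _ := by ring

/-! ### Functions that are trigonometric polynomials of bounded degree along great circles -/

section ArcPoly

variable {E : Type*} [NormedAddCommGroup E] [InnerProductSpace ℝ E]

/-- `F` is a trigonometric polynomial along great circles of the unit sphere: with
`c = cos t`, `y = sin t`, `F (c w + y v) = A(y) + c B(y)`, where `A` has degree at most `n` and the
parity of `n`, and `B` has degree less than `n` and the opposite parity. -/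
def IsArcPoly (n : ℕ) (F : E → ℝ) : Prop :=
  ∀ w v : E, ‖w‖ = 1 → ‖v‖ = 1 → inner ℝ w v = 0 → ∃ A B : ℝ[X],
    A.degree ≤ n ∧ B.degree + 1 ≤ n ∧ (∀ y, A.eval (-y) = (-1) ^ n * A.eval y) ∧
    (∀ y, B.eval (-y) = (-1) ^ (n + 1) * B.eval y) ∧
    ∀ c y : ℝ, c ^ 2 + y ^ 2 = 1 → F (c • w + y • v) = A.eval y + c * B.eval y

theorem IsArcPoly.const (a : ℝ) : IsArcPoly 0 (fun _ : E => a) := fun _ _ _ _ _ =>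
  ⟨C a, 0, by simpa using degree_C_le, by simp, by simp, by simp, by simp⟩

theorem IsArcPoly.linear (f : E →ₗ[ℝ] ℝ) : IsArcPoly 1 (fun q => f q) := fun w v _ _ _ =>
  ⟨C (f v) * X, C (f w), by simpa using degree_C_mul_X_le (f v), by
    simpa using add_le_add_left (degree_C_le (a := f w)) 1, by simp, by simp, by
    intro c y _; simp; ring⟩

theorem IsArcPoly.add {n : ℕ} {F G : E → ℝ} (hF : IsArcPoly n F) (hG : IsArcPoly n G) :
    IsArcPoly n (fun q => F q + G q) := by
  intro w v hw hv h
  obtain ⟨A, B, hA, hB, pA, pB, e⟩ := hF w v hw hv h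
  obtain ⟨A', B', hA', hB', pA', pB', e'⟩ := hG w v hw hv h
  refine ⟨A + A', B + B', (degree_add_le _ _).trans (max_le hA hA'), ?_, ?_, ?_, ?_⟩
  · rcases max_cases B.degree B'.degree with ⟨hm, _⟩ | ⟨hm, _⟩
    · exact (add_le_add_left ((degree_add_le _ _).trans hm.le) 1).trans hB
    · exact (add_le_add_left ((degree_add_le _ _).trans hm.le) 1).trans hB'
  · intro y; rw [eval_add, eval_add, pA, pA']; ring
  · intro y; rw [eval_add, eval_add, pB, pB']; ring
  · intro c y hc; beta_reduce; rw [e c y hc, e' c y hc, eval_add, eval_add]; ring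

/-- The product of the two cosine terms is c² B B', and c² = 1 - y² turns it into an algebraic
polynomial in y of the right degree and parity. -/
theorem IsArcPoly.mul {n k : ℕ} {F G : E → ℝ} (hF : IsArcPoly n F) (hG : IsArcPoly k G) :
    IsArcPoly (n + k) (fun q => F q * G q) := by
  intro w v hw hv h
  obtain ⟨A, B, hA, hB, pA, pB, e⟩ := hF w v hw hv h
  obtain ⟨A', B', hA', hB', pA', pB', e'⟩ := hG w v hw hv h
  refine ⟨A * A' + (1 - X ^ 2) * (B * B'), A * B' + B * A', ?_, ?_, ?_, ?_, ?_⟩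
  · refine (degree_add_le _ _).trans (max_le ?_ ?_)
    · rw [degree_mul]; push_cast; exact add_le_add hA hA'
    · have h2 : ((1 : ℝ[X]) - X ^ 2).degree ≤ 2 := by compute_degree
      rw [degree_mul, degree_mul]
      push_cast
      calc ((1 : ℝ[X]) - X ^ 2).degree + (B.degree + B'.degree)
          ≤ 2 + (B.degree + B'.degree) := by gcongr
        _ = (B.degree + 1) + (B'.degree + 1) := by rw [← one_add_one_eq_two]; abel
        _ ≤ _ := add_le_add hB hB'
  · have d1 : (A * B').degree + 1 ≤ ((n + k : ℕ) : WithBot ℕ) := by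
      rw [degree_mul, add_assoc]; push_cast; exact add_le_add hA hB'
    have d2 : (B * A').degree + 1 ≤ ((n + k : ℕ) : WithBot ℕ) := by
      rw [degree_mul, add_right_comm]; push_cast; exact add_le_add hB hA'
    rcases max_cases (A * B').degree (B * A').degree with ⟨hm, _⟩ | ⟨hm, _⟩
    · exact (add_le_add_left ((degree_add_le _ _).trans hm.le) 1).trans d1
    · exact (add_le_add_left ((degree_add_le _ _).trans hm.le) 1).trans d2
  · intro y
    simp only [eval_add, eval_mul, eval_sub, eval_one, eval_pow, eval_X, pA, pB, pA', pB']
    ring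
  · intro y
    simp only [eval_add, eval_mul, pA, pB, pA', pB']
    ring
  · intro c y hc
    beta_reduce
    rw [e c y hc, e' c y hc]
    simp only [eval_add, eval_mul, eval_sub, eval_one, eval_pow, eval_X]
    linear_combination B.eval y * B'.eval y * hc

/-- The index also records parity, so it may only be raised by an even number. -/
theorem IsArcPoly.mono {n k : ℕ} (h : n ≤ k) (hp : Even (k - n)) {F : E → ℝ}
    (hF : IsArcPoly n F) : IsArcPoly k F := by
  intro w v hw hv ho
  obtain ⟨A, B, hA, hB, pA, pB, e⟩ := hF w v hw hv ho
  have hk : ((-1 : ℝ)) ^ k = (-1) ^ n := by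
    rw [← Nat.sub_add_cancel h, pow_add, hp.neg_one_pow, one_mul]
  refine ⟨A, B, hA.trans (by exact_mod_cast h), hB.trans (by exact_mod_cast h), ?_, ?_, e⟩
  · simpa [hk] using pA
  · simpa [pow_succ, hk] using pB

theorem IsArcPoly.const_mul {n : ℕ} {F : E → ℝ} (a : ℝ) (hF : IsArcPoly n F) :
    IsArcPoly n (fun q => a * F q) := by
  simpa using (IsArcPoly.const a).mul hF

/-- A complex function whose real and imaginary parts satisfy `IsArcPoly`. -/
def IsComplexArcPoly (n : ℕ) (F : E → ℂ) : Prop :=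
  IsArcPoly n (fun q => (F q).re) ∧ IsArcPoly n (fun q => (F q).im)

theorem IsComplexArcPoly.mul {n k : ℕ} {F G : E → ℂ} (hF : IsComplexArcPoly n F)
    (hG : IsComplexArcPoly k G) : IsComplexArcPoly (n + k) (fun q => F q * G q) := by
  refine ⟨?_, ?_⟩
  · have := (hF.1.mul hG.1).add ((hF.2.mul hG.2).const_mul (-1))
    simpa [Complex.mul_re, ← sub_eq_add_neg] using this
  · have := (hF.1.mul hG.2).add (hF.2.mul hG.1)
    simpa [Complex.mul_im] using this

theorem IsComplexArcPoly.add {n : ℕ} {F G : E → ℂ} (hF : IsComplexArcPoly n F)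
    (hG : IsComplexArcPoly n G) : IsComplexArcPoly n (fun q => F q + G q) :=
  ⟨by simpa using hF.1.add hG.1, by simpa using hF.2.add hG.2⟩

theorem IsComplexArcPoly.const (a : ℂ) : IsComplexArcPoly 0 (fun _ : E => a) :=
  ⟨IsArcPoly.const _, IsArcPoly.const _⟩

theorem IsComplexArcPoly.const_mul {n : ℕ} {F : E → ℂ} (a : ℂ) (hF : IsComplexArcPoly n F) :
    IsComplexArcPoly n (fun q => a * F q) := by
  simpa using (IsComplexArcPoly.const a).mul hF

theorem IsComplexArcPoly.pow {n : ℕ} {F : E → ℂ} (hF : IsComplexArcPoly n F) (k : ℕ) :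
    IsComplexArcPoly (k * n) (fun q => F q ^ k) := by
  induction k with
  | zero => simpa using IsComplexArcPoly.const (E := E) 1
  | succ k ih => simpa [pow_succ, add_mul] using ih.mul hF

theorem IsComplexArcPoly.zero (n : ℕ) : IsComplexArcPoly n (fun _ : E => 0) := by
  have : IsArcPoly n (fun _ : E => (0 : ℝ)) := fun _ _ _ _ _ =>
    ⟨0, 0, by simp, by simp, by simp, by simp, by simp⟩
  exact ⟨this, this⟩

theorem IsComplexArcPoly.sum {ι : Type*} {n : ℕ} {F : ι → E → ℂ} (s : Finset ι)
    (hF : ∀ i ∈ s, IsComplexArcPoly n (F i)) : IsComplexArcPoly n (fun q => ∑ i ∈ s, F i q) := by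
  classical
  induction s using Finset.induction_on with
  | empty => simpa using IsComplexArcPoly.zero n
  | insert i s hi ih =>
    simp only [Finset.sum_insert hi]
    exact (hF i (Finset.mem_insert_self i s)).add
      (ih fun j hj => hF j (Finset.mem_insert_of_mem hj))

theorem IsComplexArcPoly.mono {n k : ℕ} (h : n ≤ k) (hp : Even (k - n)) {F : E → ℂ}
    (hF : IsComplexArcPoly n F) : IsComplexArcPoly k F :=
  ⟨hF.1.mono h hp, hF.2.mono h hp⟩

end ArcPoly

/-! ### A norming inequality on spherical caps -/

section Cap

variable {E : Type*} [NormedAddCommGroup E] [InnerProductSpace ℝ E]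

/-- Normalizing moves x by |1 - ‖x‖|, which is itself at most ‖x - u‖ because u is a unit vector. -/
theorem norm_inv_norm_smul_sub_le {x u : E} (hx : x ≠ 0) (hu : ‖u‖ = 1) :
    ‖‖x‖⁻¹ • x - u‖ ≤ 2 * ‖x - u‖ := by
  have hx' : 0 < ‖x‖ := norm_pos_iff.mpr hx
  have h1 : ‖‖x‖⁻¹ • x - x‖ = |1 - ‖x‖| := by
    have : ‖x‖⁻¹ • x - x = (‖x‖⁻¹ - 1) • x := by rw [sub_smul, one_smul]
    rw [this, norm_smul, Real.norm_eq_abs, ← abs_of_pos hx', ← abs_mul, abs_of_pos hx', sub_mul,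
      inv_mul_cancel₀ hx'.ne', one_mul]
  have h2 : |1 - ‖x‖| ≤ ‖x - u‖ := by
    rw [← hu, norm_sub_rev]; exact abs_norm_sub_norm_le u x
  calc ‖‖x‖⁻¹ • x - u‖ ≤ ‖‖x‖⁻¹ • x - x‖ + ‖x - u‖ := norm_sub_le_norm_sub_add_norm_sub _ _ _
    _ ≤ _ := by rw [h1]; linarith

theorem norm_sub_sq_of_unit {u v : E} (hu : ‖u‖ = 1) (hv : ‖v‖ = 1) :
    ‖u - v‖ ^ 2 = 2 - 2 * inner ℝ u v := by
  rw [norm_sub_sq_real, hu, hv]; ring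

/-- Small spherical caps are geodesically convex. -/
theorem norm_combination_sub_le {α β γ : E} (hα : ‖α‖ = 1) (hβ : ‖β‖ = 1) (hγ : ‖γ‖ = 1) {r : ℝ}
    (hr0 : 0 ≤ r) (hr : r ≤ 1) (hβα : ‖β - α‖ ≤ r) (hγα : ‖γ - α‖ ≤ r) {x y : ℝ} (hx : 0 ≤ x)
    (hy : 0 ≤ y) (hu : ‖x • β + y • γ‖ = 1) : ‖x • β + y • γ - α‖ ≤ r := by
  -- On the unit sphere the cap is the set where the inner product with α is at least 1 - r²/2 ≥ 0;
  -- nonnegative combinations with x + y ≥ 1 preserve this bound.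
  have hxy : 1 ≤ x + y := by
    rw [← hu]
    refine (norm_add_le _ _).trans ?_
    rw [norm_smul, norm_smul, hβ, hγ, Real.norm_of_nonneg hx, Real.norm_of_nonneg hy]
    simp
  have h1 := norm_sub_sq_of_unit hβ hα
  have h2 := norm_sub_sq_of_unit hγ hα
  have h3 := norm_sub_sq_of_unit hu hα
  rw [inner_add_left, real_inner_smul_left, real_inner_smul_left] at h3
  have h1' : 1 - r ^ 2 / 2 ≤ inner ℝ β α := by nlinarith [norm_nonneg (β - α)]
  have h2' : 1 - r ^ 2 / 2 ≤ inner ℝ γ α := by nlinarith [norm_nonneg (γ - α)]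
  have hk : 0 ≤ 1 - r ^ 2 / 2 := by nlinarith
  refine le_of_sq_le_sq ?_ hr0
  rw [h3]
  nlinarith [mul_le_mul_of_nonneg_left h1' hx, mul_le_mul_of_nonneg_left h2' hy,
    mul_le_mul_of_nonneg_right hxy hk]

/-- The Markov inequality along the arc from `β` to `γ`. -/
theorem IsArcPoly.abs_sub_le {n : ℕ} (hn : 1 ≤ n) {F : E → ℝ} (hF : IsArcPoly n F) {β γ : E}
    (hβ : ‖β‖ = 1) (hγ : ‖γ‖ = 1) (hne : β ≠ γ) (hle : ‖γ - β‖ ≤ 1) {M : ℝ} (hM : 0 < M)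
    (hb : ∀ x y : ℝ, 0 ≤ x → 0 ≤ y → ‖x • β + y • γ‖ = 1 → |F (x • β + y • γ)| ≤ M)
    {x y : ℝ} (hx : 0 ≤ x) (hy : 0 ≤ y) (hu : ‖x • β + y • γ‖ = 1) :
    |F (x • β + y • γ) - F β| ≤
      7 * n ^ 2 / (‖γ - β‖ / 2) * M * ‖x • β + y • γ - β‖ := by
  -- m and k are the sine and cosine of half the angle between β and γ; in the orthonormal frame w,
  -- v below, β = k w - m v and γ = k w + m v.
  set m := ‖γ - β‖ / 2 with hmdef
  set k := ‖γ + β‖ / 2 with hkdef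
  have hm : 0 < m := half_pos (norm_pos_iff.mpr (sub_ne_zero.mpr hne.symm))
  have hkm : k ^ 2 + m ^ 2 = 1 := by
    have := parallelogram_law_with_norm ℝ γ β
    rw [hβ, hγ] at this
    rw [hmdef, hkdef]; nlinarith
  have hk0 : 0 ≤ k := by positivity
  have hk : 0 < k := by
    rcases hk0.eq_or_lt with h | h
    · rw [← h] at hkm; nlinarith
    · exact h
  set w : E := (2 * k)⁻¹ • (γ + β) with hw
  set v : E := (2 * m)⁻¹ • (γ - β) with hv
  have hkw : k • w = (1 / 2 : ℝ) • (γ + β) := by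
    rw [hw, smul_smul]; congr 1; field_simp
  have hmv : m • v = (1 / 2 : ℝ) • (γ - β) := by
    rw [hv, smul_smul]; congr 1; field_simp
  have hw1 : ‖w‖ = 1 := by
    rw [hw, norm_smul, Real.norm_of_nonneg (by positivity), show ‖γ + β‖ = 2 * k by
      rw [hkdef]; ring]
    field_simp
  have hv1 : ‖v‖ = 1 := by
    rw [hv, norm_smul, Real.norm_of_nonneg (by positivity), show ‖γ - β‖ = 2 * m by
      rw [hmdef]; ring]
    field_simp
  have hvw : inner ℝ w v = 0 := by
    rw [hw, hv, real_inner_smul_left, real_inner_smul_right,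
      (real_inner_add_sub_eq_zero_iff γ β).mpr (by rw [hβ, hγ])]
    simp
  have hβe : β = k • w + (-m) • v := by
    rw [neg_smul, hkw, hmv]; module
  have hun : ∀ c t : ℝ, ‖c • w + t • v‖ ^ 2 = c ^ 2 + t ^ 2 := by
    intro c t
    rw [norm_add_sq_real, norm_smul c, norm_smul t, real_inner_smul_left, real_inner_smul_right,
      hw1, hv1, hvw]
    simp
  obtain ⟨A, B, hA, hB, pA, pB, e⟩ := hF w v hw1 hv1 hvw
  have hB' : B.degree ≤ n := by
    refine le_trans ?_ hB
    simpa using add_le_add_right (zero_le_one : (0 : WithBot ℕ) ≤ 1) B.degree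
  have harc : ∀ c t : ℝ, 0 ≤ c → |t| ≤ m → c ^ 2 + t ^ 2 = 1 → |F (c • w + t • v)| ≤ M := by
    intro c t hc ht hct
    have ht' := abs_le.mp ht
    -- Together with |t| ≤ m this makes both coefficients of β and γ nonnegative, so the point lies
    -- between them.
    have hck : k ≤ c := by
      refine le_of_sq_le_sq ?_ hc
      nlinarith [sq_abs t, abs_nonneg t]
    have e1 : c • w + t • v = (c / (2 * k) - t / (2 * m)) • β + (c / (2 * k) + t / (2 * m)) • γ := by
      rw [hw, hv, smul_smul, smul_smul, ← div_eq_mul_inv, ← div_eq_mul_inv]; module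
    have h1 : 1 / 2 ≤ c / (2 * k) := by rw [le_div_iff₀ (by positivity)]; linarith
    have h2 : t / (2 * m) ≤ 1 / 2 := by rw [div_le_iff₀ (by positivity)]; linarith
    have h3 : -(1 / 2) ≤ t / (2 * m) := by rw [le_div_iff₀ (by positivity)]; linarith
    have h4 : ‖c • w + t • v‖ = 1 := by
      rw [← sq_eq_sq₀ (norm_nonneg _) zero_le_one, hun, hct]; norm_num
    rw [e1] at h4 ⊢
    exact hb _ _ (by linarith) (by linarith) h4
  have hξ : x • β + y • γ = ((x + y) * k) • w + ((y - x) * m) • v := by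
    rw [mul_smul, mul_smul, hkw, hmv]; module
  have hξn : ((x + y) * k) ^ 2 + ((y - x) * m) ^ 2 = 1 := by
    rw [← hun, ← hξ, hu]; norm_num
  have hd : ‖x • β + y • γ - β‖ ^ 2 = ((x + y) * k - k) ^ 2 + ((y - x) * m - -m) ^ 2 := by
    rw [← hun]
    congr 2
    rw [hξ]
    exact (congrArg (((x + y) * k) • w + ((y - x) * m) • v - ·) hβe).trans (by module)
  have hyx : |(y - x) * m| ≤ m := by
    rw [abs_mul, abs_of_pos hm]
    have : |y - x| ≤ 1 := by
      rw [abs_le_one_iff_mul_self_le_one]; nlinarith [mul_nonneg hx hy, sq_nonneg k]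
    nlinarith
  have key := abs_arc_sub_le hn hA hB' hm (by rw [hmdef]; linarith) hM
    (fun c t hc ht hct => by rw [← e c t hct]; exact harc c t hc ht hct)
    -- The arc is symmetric under t ↦ -t, and by parity this reflection turns A + cB into ±(A - cB).
    (fun c t hc ht hct => by
      have := harc c (-t) hc (by rwa [abs_neg]) (by rwa [neg_sq])
      rw [e c (-t) (by rwa [neg_sq]), pA, pB, pow_succ] at this
      rw [show (-1) ^ n * A.eval t + c * ((-1) ^ n * -1 * B.eval t) =
        (-1) ^ n * (A.eval t - c * B.eval t) by ring, abs_mul, abs_pow, abs_neg, abs_one,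
        one_pow, one_mul] at this
      exact this)
    (c₀ := k) (y₀ := -m) (c₁ := (x + y) * k) (y₁ := (y - x) * m) (D := ‖x • β + y • γ - β‖)
    (by rw [abs_neg, abs_of_pos hm]) hyx hξn
    (abs_le_of_sq_le_sq (by rw [hd]; nlinarith [sq_nonneg ((y - x) * m - -m)]) (norm_nonneg _))
    (abs_le_of_sq_le_sq (by rw [hd]; nlinarith [sq_nonneg ((x + y) * k - k)]) (norm_nonneg _))
  rw [← e _ _ hξn, ← e k (-m) (by rw [neg_sq, hkm]), ← hξ, ← hβe] at key
  exact key

/-- Rotate α towards e until its inner product with α has dropped to 1 - r²/2. -/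
theorem exists_unit_norm_sub_eq {α e : E} (hα : ‖α‖ = 1) (he : ‖e‖ = 1) (hαe : inner ℝ α e = 0)
    {r : ℝ} (hr0 : 0 ≤ r) (hr : r ≤ 1) : ∃ z : E, ‖z‖ = 1 ∧ ‖z - α‖ = r := by
  have hs : √(1 - (1 - r ^ 2 / 2) ^ 2) ^ 2 = 1 - (1 - r ^ 2 / 2) ^ 2 :=
    Real.sq_sqrt (by
      have : r ^ 2 ≤ 1 := by nlinarith
      nlinarith [mul_nonneg (sq_nonneg r) (sub_nonneg.mpr this)])
  set s := √(1 - (1 - r ^ 2 / 2) ^ 2)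
  have hz : ‖(1 - r ^ 2 / 2) • α + s • e‖ = 1 := by
    rw [← sq_eq_sq₀ (norm_nonneg _) zero_le_one, norm_add_sq_real, norm_smul, norm_smul,
      real_inner_smul_left, real_inner_smul_right, hα, he, hαe, mul_one, mul_one,
      Real.norm_eq_abs, Real.norm_eq_abs, sq_abs, sq_abs, hs]
    ring
  refine ⟨_, hz, ?_⟩
  rw [← sq_eq_sq₀ (norm_nonneg _) hr0, norm_sub_sq_of_unit hz hα, inner_add_left,
    real_inner_smul_left, real_inner_smul_left, real_inner_self_eq_norm_sq, real_inner_comm, hαe,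
    hα]
  ring

/-- Sufficiently dense subsets of the sphere are norming, locally on spherical caps. -/
theorem IsArcPoly.exists_abs_le_two_mul [ProperSpace E] {n : ℕ} (hn : 1 ≤ n) {F : E → ℝ}
    (hF : IsArcPoly n F) (hc : ContinuousOn F (Metric.sphere 0 1)) {α e : E} (hα : ‖α‖ = 1)
    (he : ‖e‖ = 1) (hαe : inner ℝ α e = 0) {r η : ℝ} (hr : r ≤ 1 / 2) (hη : 0 < η)
    (hηr : 11000 * n ^ 2 * η ≤ r) {N : Set E}
    (hN : ∀ q : E, ‖q‖ = 1 → ∃ ξ ∈ N, ‖ξ‖ = 1 ∧ ‖ξ - q‖ ≤ η) :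
    ∃ ξ ∈ N, ‖ξ‖ = 1 ∧ ‖ξ - α‖ ≤ r ∧ |F α| ≤ 2 * |F ξ| := by
  have hn1 : (1 : ℝ) ≤ n := by exact_mod_cast hn
  have hn2 : (1 : ℝ) ≤ (n : ℝ) ^ 2 := by nlinarith
  have hηr' : 11000 * η ≤ r := by nlinarith
  have hr0 : 0 < r := by linarith
  have hcomp : IsCompact (Metric.sphere (0 : E) 1 ∩ Metric.closedBall α r) :=
    (isCompact_sphere 0 1).inter_right Metric.isClosed_closedBall
  obtain ⟨β, hβS, hβ⟩ := hcomp.exists_isMaxOn (f := fun q => |F q|)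
    ⟨α, by simp [hα], by simp [hr0.le]⟩ (hc.mono Set.inter_subset_left).abs
  have hβ1 : ‖β‖ = 1 := by simpa using hβS.1
  have hβr : ‖β - α‖ ≤ r := by simpa [dist_eq_norm] using hβS.2
  have hmax : ∀ q : E, ‖q‖ = 1 → ‖q - α‖ ≤ r → |F q| ≤ |F β| := fun q h1 h2 =>
    hβ (show q ∈ Metric.sphere (0 : E) 1 ∩ Metric.closedBall α r from
      ⟨by simpa using h1, by simpa [dist_eq_norm] using h2⟩)
  have hαβ : |F α| ≤ |F β| := hmax α hα (by simp [hr0.le])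
  rcases (abs_nonneg (F β)).eq_or_lt with hM | hM
  -- If the maximum is zero, any center near α serves.
  · obtain ⟨ξ, hξ, h1, h2⟩ := hN α hα
    exact ⟨ξ, hξ, h1, by linarith, by linarith [abs_nonneg (F ξ)]⟩
  -- A target well inside the cap but far from β: α itself, unless β is close to α.
  obtain ⟨z, hz1, hzα, hzβ⟩ : ∃ z : E, ‖z‖ = 1 ∧ ‖z - α‖ ≤ r / 2 ∧ r / 4 ≤ ‖z - β‖ := by
    rcases le_total (r / 4) ‖α - β‖ with h | h
    · exact ⟨α, hα, by rw [sub_self, norm_zero]; linarith, h⟩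
    · obtain ⟨z, hz1, hz⟩ := exists_unit_norm_sub_eq hα he hαe (r := r / 2) (by linarith)
        (by linarith)
      refine ⟨z, hz1, hz.le, ?_⟩
      have := norm_sub_le_norm_sub_add_norm_sub z β α
      rw [norm_sub_rev β α] at this
      linarith
  have hzβ' : ‖z - β‖ ≤ 3 / 2 * r := by
    have := norm_sub_le_norm_sub_add_norm_sub z α β
    rw [norm_sub_rev α β] at this
    linarith
  -- The fraction of the way from β to z. It is chosen so that the error η of a center near p,
  -- magnified by 1/ε when the arc is prolonged, is only r/16.
  set ε := 16 * η / r with hε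
  have hε0 : 0 < ε := by positivity
  have hεr : ε * r = 16 * η := by rw [hε]; field_simp
  have hε1 : ε ≤ 1 := by rw [hε, div_le_one hr0]; linarith
  set p := (1 - ε) • β + ε • z with hp
  have hpβ : ‖p - β‖ ≤ 24 * η := by
    have : p - β = ε • (z - β) := by rw [hp]; module
    rw [this, norm_smul, Real.norm_of_nonneg hε0.le]
    nlinarith
  have hp0 : p ≠ 0 := by
    intro h
    rw [h, zero_sub, norm_neg, hβ1] at hpβ
    linarith
  have hp1 : ‖p‖ ≤ 1 := by
    refine (norm_add_le _ _).trans ?_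
    rw [norm_smul, norm_smul, hβ1, hz1, Real.norm_of_nonneg hε0.le,
      Real.norm_of_nonneg (by linarith)]
    linarith
  have hpp : 0 < ‖p‖ := norm_pos_iff.mpr hp0
  obtain ⟨ξ, hξN, hξ1, hξ⟩ := hN (‖p‖⁻¹ • p) (by
    rw [norm_smul, norm_inv, norm_norm, inv_mul_cancel₀ hpp.ne'])
  have hξβ : ‖ξ - β‖ ≤ 49 * η := by
    have h1 := norm_inv_norm_smul_sub_le hp0 hβ1
    have h2 := norm_sub_le_norm_sub_add_norm_sub ξ (‖p‖⁻¹ • p) β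
    linarith
  -- Solves ‖p‖ ξ = (1 - ε) β + ε g, so ξ lies on the arc from β to the normalization γ of g.
  set g := z + (‖p‖ / ε) • (ξ - ‖p‖⁻¹ • p) with hg
  have hgz : ‖g - z‖ ≤ r / 16 := by
    rw [hg, add_sub_cancel_left, norm_smul, Real.norm_of_nonneg (by positivity)]
    calc ‖p‖ / ε * ‖ξ - ‖p‖⁻¹ • p‖ ≤ 1 / ε * η := by gcongr
      _ = r / 16 := by rw [hε]; field_simp
  have hg0 : g ≠ 0 := by
    intro h
    rw [h, zero_sub, norm_neg, hz1] at hgz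
    linarith
  have hgp : 0 < ‖g‖ := norm_pos_iff.mpr hg0
  set γ := ‖g‖⁻¹ • g with hγ
  have hγ1 : ‖γ‖ = 1 := by rw [hγ, norm_smul, norm_inv, norm_norm, inv_mul_cancel₀ hgp.ne']
  have hγz : ‖γ - z‖ ≤ r / 8 := by linarith [norm_inv_norm_smul_sub_le hg0 hz1]
  have hγα : ‖γ - α‖ ≤ r := by linarith [norm_sub_le_norm_sub_add_norm_sub γ z α]
  have hγβ : r / 8 ≤ ‖γ - β‖ := by
    have := norm_sub_le_norm_sub_add_norm_sub z γ β
    rw [norm_sub_rev z γ] at this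
    linarith
  have hγβ' : ‖γ - β‖ ≤ 1 := by
    have := norm_sub_le_norm_sub_add_norm_sub γ α β
    rw [norm_sub_rev α β] at this
    linarith
  have hne : β ≠ γ := by
    rintro h
    rw [← h, sub_self, norm_zero] at hγβ
    linarith
  have hξe : ξ = (‖p‖⁻¹ * (1 - ε)) • β + (‖p‖⁻¹ * ε * ‖g‖) • γ := by
    have h1 : (‖p‖⁻¹ * ε * ‖g‖) • γ = (‖p‖⁻¹ * ε) • g := by
      rw [hγ, smul_smul, mul_assoc, mul_inv_cancel₀ hgp.ne', mul_one]
    have h2 : (‖p‖⁻¹ * ε) • g = (‖p‖⁻¹ * ε) • z + (ξ - ‖p‖⁻¹ • p) := by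
      rw [hg, smul_add, smul_smul, show ‖p‖⁻¹ * ε * (‖p‖ / ε) = 1 by field_simp, one_smul]
    have h3 : ‖p‖⁻¹ • p = (‖p‖⁻¹ * (1 - ε)) • β + (‖p‖⁻¹ * ε) • z := by
      nth_rewrite 2 [hp]
      rw [smul_add, smul_smul, smul_smul]
    rw [h1, h2, h3]
    abel
  have hx : 0 ≤ ‖p‖⁻¹ * (1 - ε) := mul_nonneg (by positivity) (by linarith)
  have hy : 0 ≤ ‖p‖⁻¹ * ε * ‖g‖ := by positivity
  have hu : ‖(‖p‖⁻¹ * (1 - ε)) • β + (‖p‖⁻¹ * ε * ‖g‖) • γ‖ = 1 := by rw [← hξe, hξ1]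
  have hcap := fun x y hx hy hu =>
    norm_combination_sub_le hα hβ1 hγ1 hr0.le (by linarith) hβr hγα (x := x) (y := y) hx hy hu
  have key := hF.abs_sub_le hn hβ1 hγ1 hne hγβ' hM
    (fun x y hx hy hu => hmax _ hu (hcap x y hx hy hu)) hx hy hu
  have hξα := hcap _ _ hx hy hu
  rw [← hξe] at key hξα
  -- With ‖γ - β‖ ≥ r/8 and ‖ξ - β‖ ≤ 49 η the factor is 7 · 16 · 49 n² η/r = 5488 n² η/r, at most
  -- 1/2 because 2 · 5488 ≤ 11000.
  have hsmall : 7 * (n : ℝ) ^ 2 / (‖γ - β‖ / 2) * |F β| * ‖ξ - β‖ ≤ |F β| / 2 := by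
    calc 7 * (n : ℝ) ^ 2 / (‖γ - β‖ / 2) * |F β| * ‖ξ - β‖
        ≤ 7 * (n : ℝ) ^ 2 / (r / 8 / 2) * |F β| * (49 * η) := by gcongr
      _ = 5488 * n ^ 2 * η / r * |F β| := by field_simp; ring
      _ ≤ 1 / 2 * |F β| := by
        refine mul_le_mul_of_nonneg_right ?_ hM.le
        rw [div_le_iff₀ hr0]
        linarith [mul_nonneg (sq_nonneg (n : ℝ)) hη.le]
      _ = _ := by ring
  refine ⟨ξ, hξN, hξ1, hξα, ?_⟩
  have h1 := abs_sub_abs_le_abs_sub (F β) (F ξ)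
  rw [abs_sub_comm] at h1
  linarith

end Cap

/-! ### Wigner D-functions in quaternion coordinates -/

theorem Polynomial.iterate_derivative_one_sub_X_pow (n k : ℕ) :
    derivative^[k] ((1 - X : ℝ[X]) ^ n) =
      C ((-1) ^ k * (n.descFactorial k : ℝ)) * (1 - X) ^ (n - k) := by
  have h := iterate_derivative_comp_one_sub_X (X ^ n : ℝ[X]) k
  rw [iterate_derivative_X_pow_eq_C_mul] at h
  simp only [X_pow_comp, mul_comp, C_comp] at h
  rw [h, C_mul, C_pow, C_neg, C_1, mul_assoc]

theorem Polynomial.iterate_derivative_one_add_X_pow (n k : ℕ) :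
    derivative^[k] ((1 + X : ℝ[X]) ^ n) =
      C (n.descFactorial k : ℝ) * (1 + X) ^ (n - k) := by
  have h := iterate_derivative_X_add_pow n k (1 : ℝ)
  rw [C_1, add_comm X 1] at h
  rw [h, nsmul_eq_mul, C_eq_natCast]

/-- The Rodrigues-type derivative in the Wigner functions, by the Leibniz rule. -/
theorem exists_iterate_derivative_eq_sum (N a b : ℕ) :
    ∃ c : ℕ → ℝ, (∀ j ∈ Finset.range (N + 1), ¬ (N - j ≤ a ∧ j ≤ b) → c j = 0) ∧
      ∀ t : ℝ, (derivative^[N] ((1 - X) ^ a * (1 + X) ^ b : ℝ[X])).eval t =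
        ∑ j ∈ Finset.range (N + 1), c j * ((1 - t) ^ (a - (N - j)) * (1 + t) ^ (b - j)) := by
  refine ⟨fun j => N.choose j * ((-1) ^ (N - j) * a.descFactorial (N - j)) * b.descFactorial j,
    fun j _ hj => ?_, fun t => ?_⟩
  · rcases not_and_or.mp hj with h | h
    · simp [Nat.descFactorial_eq_zero_iff_lt.mpr (not_le.mp h)]
    · simp [Nat.descFactorial_eq_zero_iff_lt.mpr (not_le.mp h)]
  · rw [iterate_derivative_mul, eval_finsetSum]
    refine Finset.sum_congr rfl fun j _ => ?_
    rw [iterate_derivative_one_sub_X_pow, iterate_derivative_one_add_X_pow]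
    simp
    ring

/-- The half-integer powers in the Wigner functions combine with the Rodrigues terms into natural
powers. The convention 0 ^ s = 0 for s ≠ 0 keeps this true at x = 0, that is, at the endpoints t =
±1. -/
theorem rpow_half_sub_mul_pow {x : ℝ} (hx : 0 ≤ x) (A B : ℕ) :
    (x ^ 2) ^ (((B : ℝ) - A) / 2) * (x ^ 2) ^ A = x ^ (A + B) := by
  rcases hx.eq_or_lt with h | h
  · subst h
    by_cases hAB : A = B
    · subst hAB
      rcases Nat.eq_zero_or_pos A with hA | hA
      · simp [hA]
      · simp [hA.ne']
    · have h1 : ((B : ℝ) - A) / 2 ≠ 0 := by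
        intro h0
        exact hAB (by exact_mod_cast (by linarith : (A : ℝ) = B))
      have h2 : A + B ≠ 0 := by omega
      rw [zero_pow two_ne_zero, Real.zero_rpow h1, zero_mul, zero_pow h2]
  · rw [← Real.rpow_natCast (x ^ 2) A, ← Real.rpow_add (by positivity),
      ← Real.rpow_natCast x 2, ← Real.rpow_mul hx, ← Real.rpow_natCast x (A + B)]
    congr 1
    push_cast
    ring

namespace RotationGroup

theorem exp_mul_conj_pow (r σ : ℝ) (A B : ℕ) :
    (r * Complex.exp (-Complex.I * σ)) ^ A *
        (starRingEnd ℂ (r * Complex.exp (-Complex.I * σ))) ^ B =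
      ((r ^ (A + B) : ℝ) : ℂ) * Complex.exp (-Complex.I * σ * ((A : ℤ) - (B : ℤ) : ℤ)) := by
  rw [map_mul, Complex.conj_ofReal, ← Complex.exp_conj, mul_pow, mul_pow, ← Complex.exp_nat_mul,
    ← Complex.exp_nat_mul]
  have : Complex.exp (-Complex.I * σ * ((A : ℤ) - (B : ℤ) : ℤ)) =
      Complex.exp (A * (-Complex.I * σ)) *
        Complex.exp (B * (starRingEnd ℂ) (-Complex.I * σ)) := by
    rw [← Complex.exp_add]
    congr 1
    simp
    ring
  rw [this]
  push_cast
  ring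

/-- The Wigner functions are homogeneous polynomials of degree `2 ℓ` in the complex coordinates
`cos (θ/2) e^(-i σ)`, `sin (θ/2) e^(-i δ)` and their conjugates, where `φ₁ = σ + δ` and
`φ₂ = σ - δ`. -/
theorem exists_wignerDEuler_eq_sum {ℓ : ℕ} {k m : ℤ} (hk : |k| ≤ ℓ) (hm : |m| ≤ ℓ) :
    ∃ (N : ℕ) (c : ℕ → ℂ) (e₁ e₂ e₃ e₄ : ℕ → ℕ),
      (∀ j ∈ Finset.range N, e₁ j + e₂ j + (e₃ j + e₄ j) = 2 * ℓ) ∧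
      ∀ σ δ θ : ℝ, 0 ≤ θ → θ ≤ Real.pi →
        wignerDEuler ℓ k m (σ + δ) θ (σ - δ) = ∑ j ∈ Finset.range N, c j *
          ((Real.cos (θ / 2) * Complex.exp (-Complex.I * σ)) ^ e₁ j *
            (starRingEnd ℂ (Real.cos (θ / 2) * Complex.exp (-Complex.I * σ))) ^ e₂ j *
          ((Real.sin (θ / 2) * Complex.exp (-Complex.I * δ)) ^ e₃ j *
            (starRingEnd ℂ (Real.sin (θ / 2) * Complex.exp (-Complex.I * δ))) ^ e₄ j)) := by
  obtain ⟨hk1, hk2⟩ := abs_le.mp hk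
  obtain ⟨hm1, hm2⟩ := abs_le.mp hm
  obtain ⟨a, ha⟩ := Int.eq_ofNat_of_zero_le (sub_nonneg.mpr hk2)
  obtain ⟨b, hb⟩ := Int.eq_ofNat_of_zero_le (show 0 ≤ (ℓ : ℤ) + k by omega)
  obtain ⟨N, hN⟩ := Int.eq_ofNat_of_zero_le (sub_nonneg.mpr hm2)
  obtain ⟨c, hc0, hc⟩ := exists_iterate_derivative_eq_sum N a b
  by_cases hz : ∃ j ∈ Finset.range (N + 1), N - j ≤ a ∧ j ≤ b
  swap
  · refine ⟨0, 0, 0, 0, 0, 0, by simp, fun σ δ θ _ _ => ?_⟩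
    have : ∀ t, wignerP ℓ k m t = 0 := by
      intro t
      rw [wignerP, ha, hb, hN, Int.toNat_natCast, Int.toNat_natCast, Int.toNat_natCast, hc,
        Finset.sum_eq_zero]
      · simp
      · intro j hj
        rw [hc0 j hj (fun h => hz ⟨j, hj, h⟩), zero_mul]
    simp [wignerDEuler, this]
  obtain ⟨j₀, hj₀, hj₁, hj₂⟩ := hz
  classical
  -- For indices with vanishing coefficient the truncated subtractions could spoil homogeneity, so
  -- these indices borrow the exponents of the valid index `j₀`.
  set f : ℕ → ℕ := fun j => if N - j ≤ a ∧ j ≤ b then j else j₀ with hf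
  have hfj : ∀ j ∈ Finset.range (N + 1), f j ≤ N ∧ N - f j ≤ a ∧ f j ≤ b := by
    intro j hj
    rw [Finset.mem_range] at hj hj₀
    simp only [hf]
    split_ifs with h
    · exact ⟨by omega, h.1, h.2⟩
    · exact ⟨by omega, hj₁, hj₂⟩
  -- The power of √2 comes from 1 - cos θ = 2 sin²(θ/2) and 1 + cos θ = 2 cos²(θ/2).
  refine ⟨N + 1, fun j => wignerConst ℓ k m * (c j : ℂ) * (√2 : ℂ) ^ (2 * ℓ),
    fun j => b - f j, fun j => N - f j, f, fun j => a - (N - f j), ?_, ?_⟩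
  · intro j hj
    obtain ⟨h1, h2, h3⟩ := hfj j hj
    beta_reduce
    omega
  · intro σ δ θ h0 hπ
    have hu : 0 ≤ Real.sin (θ / 2) :=
      Real.sin_nonneg_of_nonneg_of_le_pi (by linarith) (by linarith)
    have hv : 0 ≤ Real.cos (θ / 2) :=
      Real.cos_nonneg_of_neg_pi_div_two_le_of_le (by linarith) (by linarith)
    have h2 : (√2 : ℝ) ^ 2 = 2 := Real.sq_sqrt (by norm_num)
    have hcos : Real.cos θ = 2 * Real.cos (θ / 2) ^ 2 - 1 := by
      rw [← Real.cos_two_mul]; congr 1; ring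
    have hsc := Real.sin_sq_add_cos_sq (θ / 2)
    have hx : 1 - Real.cos θ = (√2 * Real.sin (θ / 2)) ^ 2 := by
      rw [mul_pow, h2, hcos]; linarith
    have hy : 1 + Real.cos θ = (√2 * Real.cos (θ / 2)) ^ 2 := by
      rw [mul_pow, h2, hcos]; linarith
    have hphase : Complex.exp (-Complex.I * k * ((σ + δ : ℝ) : ℂ)) *
        Complex.exp (-Complex.I * m * ((σ - δ : ℝ) : ℂ)) =
        Complex.exp (-Complex.I * σ * (k + m : ℤ)) * Complex.exp (-Complex.I * δ * (k - m : ℤ)) := by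
      rw [← Complex.exp_add, ← Complex.exp_add]
      congr 1
      push_cast
      ring
    rw [wignerDEuler, mul_right_comm, hphase, wignerP, ha, hb, hN, Int.toNat_natCast,
      Int.toNat_natCast, Int.toNat_natCast, hc, Finset.mul_sum, Complex.ofReal_sum,
      Finset.mul_sum, Finset.mul_sum]
    refine Finset.sum_congr rfl fun j hj => ?_
    by_cases hjj : N - j ≤ a ∧ j ≤ b
    swap
    · beta_reduce; rw [hc0 j hj hjj]; simp
    have hfe : f j = j := by simp only [hf]; rw [if_pos hjj]
    have hjN : j ≤ N := by rw [Finset.mem_range] at hj; omega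
    beta_reduce
    rw [hfe, exp_mul_conj_pow, exp_mul_conj_pow]
    have e1 : ((b - j : ℕ) : ℤ) - ((N - j : ℕ) : ℤ) = k + m := by omega
    have e2 : ((j : ℕ) : ℤ) - ((a - (N - j) : ℕ) : ℤ) = k - m := by omega
    rw [e1, e2]
    have r1 : (-((m : ℝ) - k) / 2) = ((j : ℝ) - ((a - (N - j) : ℕ) : ℝ)) / 2 := by
      have : (((j : ℕ) : ℤ) : ℝ) - (((a - (N - j) : ℕ) : ℤ) : ℝ) = k - m := by exact_mod_cast e2
      push_cast at this
      rw [this]; ring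
    have r2 : (-((m : ℝ) + k) / 2) = (((N - j : ℕ) : ℝ) - ((b - j : ℕ) : ℝ)) / 2 := by
      have : (((b - j : ℕ) : ℤ) : ℝ) - (((N - j : ℕ) : ℤ) : ℝ) = k + m := by exact_mod_cast e1
      simp only [Int.cast_natCast] at this
      linarith
    have hmain : (1 - Real.cos θ) ^ (-((m : ℝ) - k) / 2) * (1 + Real.cos θ) ^ (-((m : ℝ) + k) / 2) *
        (c j * ((1 - Real.cos θ) ^ (a - (N - j)) * (1 + Real.cos θ) ^ (b - j))) =
        c j * √2 ^ (2 * ℓ) * (Real.cos (θ / 2) ^ (b - j + (N - j)) *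
          Real.sin (θ / 2) ^ (j + (a - (N - j)))) := by
      have s1 := rpow_half_sub_mul_pow (x := √2 * Real.sin (θ / 2)) (by positivity) (a - (N - j)) j
      have s2 := rpow_half_sub_mul_pow (x := √2 * Real.cos (θ / 2)) (by positivity) (b - j) (N - j)
      rw [r1, r2, hx, hy]
      calc _ = c j * ((((√2 * Real.sin (θ / 2)) ^ 2) ^ (((j : ℝ) - ((a - (N - j) : ℕ) : ℝ)) / 2) *
              ((√2 * Real.sin (θ / 2)) ^ 2) ^ (a - (N - j))) *
            (((√2 * Real.cos (θ / 2)) ^ 2) ^ ((((N - j : ℕ) : ℝ) - ((b - j : ℕ) : ℝ)) / 2) *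
              ((√2 * Real.cos (θ / 2)) ^ 2) ^ (b - j))) := by ring
        _ = _ := by
          rw [s1, s2, mul_pow, mul_pow, add_comm (a - (N - j)) j,
            show 2 * ℓ = (j + (a - (N - j))) + (b - j + (N - j)) by omega, pow_add (√2)]
          ring
    rw [hmain]
    push_cast
    ring

/-! ### The covering of `SO(3)` by unit quaternions -/

/-- The Euclidean space of quaternions. -/
abbrev Quat : Type := EuclideanSpace ℝ (Fin 4)

theorem Quat.norm_sq (q : Quat) : ‖q‖ ^ 2 = q 0 ^ 2 + q 1 ^ 2 + q 2 ^ 2 + q 3 ^ 2 := by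
  rw [EuclideanSpace.real_norm_sq_eq, Fin.sum_univ_four]

theorem Quat.inner_eq (p q : Quat) :
    inner ℝ p q = p 0 * q 0 + p 1 * q 1 + p 2 * q 2 + p 3 * q 3 := by
  rw [PiLp.inner_apply, Fin.sum_univ_four]
  simp [mul_comm]

/-- The rotation matrix of a quaternion. -/
def quatMatrix (q : Quat) : Matrix (Fin 3) (Fin 3) ℝ :=
  !![q 0 ^ 2 + q 1 ^ 2 - q 2 ^ 2 - q 3 ^ 2, 2 * (q 1 * q 2 - q 0 * q 3),
      2 * (q 1 * q 3 + q 0 * q 2);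
    2 * (q 1 * q 2 + q 0 * q 3), q 0 ^ 2 - q 1 ^ 2 + q 2 ^ 2 - q 3 ^ 2,
      2 * (q 2 * q 3 - q 0 * q 1);
    2 * (q 1 * q 3 - q 0 * q 2), 2 * (q 2 * q 3 + q 0 * q 1),
      q 0 ^ 2 - q 1 ^ 2 - q 2 ^ 2 + q 3 ^ 2]

theorem quatMatrix_mem {q : Quat} (hq : ‖q‖ = 1) :
    quatMatrix q ∈ Matrix.specialOrthogonalGroup (Fin 3) ℝ := by
  have h : q 0 ^ 2 + q 1 ^ 2 + q 2 ^ 2 + q 3 ^ 2 = 1 := by rw [← Quat.norm_sq, hq]; norm_num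
  rw [Matrix.mem_specialOrthogonalGroup_iff, Matrix.mem_orthogonalGroup_iff]
  refine ⟨?_, ?_⟩
  · have hone : (q 0 ^ 2 + q 1 ^ 2 + q 2 ^ 2 + q 3 ^ 2) ^ 2 = 1 := by rw [h]; norm_num
    ext i j
    fin_cases i <;> fin_cases j <;>
      simp [quatMatrix, Matrix.mul_apply, Fin.sum_univ_three] <;>
      first | ring1 | linear_combination hone
  · have hone : (q 0 ^ 2 + q 1 ^ 2 + q 2 ^ 2 + q 3 ^ 2) ^ 3 = 1 := by rw [h]; norm_num
    simp [quatMatrix, Matrix.det_fin_three]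
    linear_combination hone

/-- The rotation given by a unit quaternion. -/
def ofQuat (q : Metric.sphere (0 : Quat) 1) : SO3 :=
  ⟨quatMatrix q, quatMatrix_mem (by simp)⟩

theorem continuous_ofQuat : Continuous ofQuat := by
  refine Continuous.subtype_mk (continuous_matrix fun i j => ?_) _
  fin_cases i <;> fin_cases j <;> simp [quatMatrix] <;> fun_prop

/-- Compared with tr = 1 + 2 cos ω, this says cos ω = 2⟨p, q⟩² - 1: rotation angles double the
angles between quaternions. -/
theorem trace_inv_mul_ofQuat (p q : Metric.sphere (0 : Quat) 1) :
    Matrix.trace (((ofQuat p)⁻¹ * ofQuat q : SO3) : Matrix (Fin 3) (Fin 3) ℝ) =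
      4 * (inner ℝ p.1 q.1) ^ 2 - 1 := by
  have hp : p.1 0 ^ 2 + p.1 1 ^ 2 + p.1 2 ^ 2 + p.1 3 ^ 2 = 1 := by
    rw [← Quat.norm_sq, show ‖p.1‖ = 1 by simp]; norm_num
  have hq : q.1 0 ^ 2 + q.1 1 ^ 2 + q.1 2 ^ 2 + q.1 3 ^ 2 = 1 := by
    rw [← Quat.norm_sq, show ‖q.1‖ = 1 by simp]; norm_num
  have h : (((ofQuat p)⁻¹ * ofQuat q : SO3) : Matrix (Fin 3) (Fin 3) ℝ) =
      (quatMatrix p.1).transpose * quatMatrix q.1 := rfl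
  rw [h, Quat.inner_eq]
  simp [Matrix.trace, Fin.sum_univ_three, Matrix.mul_apply, quatMatrix]
  linear_combination (-(q.1 0 ^ 2 + q.1 1 ^ 2 + q.1 2 ^ 2 + q.1 3 ^ 2)) * hp - hq

theorem coe_ofEuler_eq_quatMatrix {q : Quat} {σ δ θ : ℝ}
    (h0 : q 0 = Real.cos (θ / 2) * Real.cos σ) (h3 : q 3 = Real.cos (θ / 2) * Real.sin σ)
    (h1 : q 1 = Real.sin (θ / 2) * Real.cos δ) (h2 : q 2 = Real.sin (θ / 2) * Real.sin δ) :
    (ofEuler (σ + δ) θ (σ - δ)).1 = quatMatrix q := by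
  have hc : Real.cos θ = Real.cos (θ / 2) ^ 2 - Real.sin (θ / 2) ^ 2 := by
    rw [← Real.cos_two_mul']; congr 1; ring
  have hs : Real.sin θ = 2 * Real.sin (θ / 2) * Real.cos (θ / 2) := by
    rw [← Real.sin_two_mul]; congr 1; ring
  have e := Real.sin_sq_add_cos_sq (θ / 2)
  have eσ := Real.sin_sq_add_cos_sq σ
  have eδ := Real.sin_sq_add_cos_sq δ
  have p1 : Real.cos (σ + δ) * Real.cos (σ - δ) - Real.sin (σ + δ) * Real.sin (σ - δ) =
      Real.cos σ ^ 2 - Real.sin σ ^ 2 := by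
    rw [← Real.cos_add, ← Real.cos_two_mul']; congr 1; ring
  have p2 : Real.cos (σ + δ) * Real.cos (σ - δ) + Real.sin (σ + δ) * Real.sin (σ - δ) =
      Real.cos δ ^ 2 - Real.sin δ ^ 2 := by
    rw [← Real.cos_sub, ← Real.cos_two_mul']; congr 1; ring
  have p3 : Real.sin (σ + δ) * Real.cos (σ - δ) + Real.cos (σ + δ) * Real.sin (σ - δ) =
      2 * Real.sin σ * Real.cos σ := by
    rw [← Real.sin_add, ← Real.sin_two_mul]; congr 1; ring
  have p4 : Real.sin (σ + δ) * Real.cos (σ - δ) - Real.cos (σ + δ) * Real.sin (σ - δ) =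
      2 * Real.sin δ * Real.cos δ := by
    rw [← Real.sin_sub, ← Real.sin_two_mul]; congr 1; ring
  rw [coe_ofEuler, quatMatrix, hc, hs, h0, h1, h2, h3]
  ext i j
  fin_cases i <;> fin_cases j <;> simp
  · linear_combination Real.cos (θ / 2) ^ 2 * p1 + Real.sin (θ / 2) ^ 2 * p2 -
      Real.cos (σ + δ) * Real.cos (σ - δ) * e
  · linear_combination -Real.cos (θ / 2) ^ 2 * p3 + Real.sin (θ / 2) ^ 2 * p4 +
      Real.cos (σ + δ) * Real.sin (σ - δ) * e
  · rw [Real.sin_add]; ring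
  · linear_combination Real.cos (θ / 2) ^ 2 * p3 + Real.sin (θ / 2) ^ 2 * p4 -
      Real.sin (σ + δ) * Real.cos (σ - δ) * e
  · linear_combination Real.cos (θ / 2) ^ 2 * p1 - Real.sin (θ / 2) ^ 2 * p2 +
      Real.sin (σ + δ) * Real.sin (σ - δ) * e
  · rw [Real.cos_add]; ring
  · rw [Real.sin_sub]; ring
  · rw [Real.cos_sub]; ring
  · linear_combination -Real.cos (θ / 2) ^ 2 * eσ + Real.sin (θ / 2) ^ 2 * eδ

/-- Polar coordinates in the planes (q₀, q₃) and (q₁, q₂): the radii are nonnegative with squares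
summing to 1, hence are cos(θ/2) and sin(θ/2) for some θ in [0, π]. -/
theorem exists_ofEuler_eq_ofQuat (q : Metric.sphere (0 : Quat) 1) :
    ∃ σ δ θ : ℝ, 0 ≤ θ ∧ θ ≤ Real.pi ∧ ofQuat q = ofEuler (σ + δ) θ (σ - δ) ∧
      q.1 0 = Real.cos (θ / 2) * Real.cos σ ∧ q.1 3 = Real.cos (θ / 2) * Real.sin σ ∧
      q.1 1 = Real.sin (θ / 2) * Real.cos δ ∧ q.1 2 = Real.sin (θ / 2) * Real.sin δ := by
  have hq : q.1 0 ^ 2 + q.1 1 ^ 2 + q.1 2 ^ 2 + q.1 3 ^ 2 = 1 := by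
    rw [← Quat.norm_sq, show ‖q.1‖ = 1 by simp]; norm_num
  obtain ⟨r, σ, hr, h0, h3⟩ := exists_polar (q.1 0) (q.1 3)
  obtain ⟨s, δ, hs, h1, h2⟩ := exists_polar (q.1 1) (q.1 2)
  have hrs : r ^ 2 + s ^ 2 = 1 := by
    rw [← hq, h0, h1, h2, h3]
    linear_combination -r ^ 2 * Real.sin_sq_add_cos_sq σ - s ^ 2 * Real.sin_sq_add_cos_sq δ
  have hθ : 2 * Real.arccos r / 2 = Real.arccos r := by ring
  have hc : Real.cos (2 * Real.arccos r / 2) = r := by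
    rw [hθ, Real.cos_arccos (by linarith) (by nlinarith)]
  have hsn : Real.sin (2 * Real.arccos r / 2) = s := by
    rw [hθ, Real.sin_arccos, show 1 - r ^ 2 = s ^ 2 by linarith, Real.sqrt_sq hs]
  have hle : 2 * Real.arccos r ≤ Real.pi := by
    linarith [Real.arccos_le_pi_div_two.mpr hr]
  refine ⟨σ, δ, 2 * Real.arccos r, mul_nonneg zero_le_two (Real.arccos_nonneg _), hle, ?_, ?_, ?_,
    ?_, ?_⟩
  · exact Subtype.ext (coe_ofEuler_eq_quatMatrix (by rw [hc, h0]) (by rw [hc, h3])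
      (by rw [hsn, h1]) (by rw [hsn, h2])).symm
  all_goals first | rw [hc]; assumption | rw [hsn]; assumption

theorem surjective_ofQuat : Function.Surjective ofQuat := by
  intro x
  obtain ⟨φ₁, θ, φ₂, -, -, rfl⟩ := exists_ofEuler x
  set σ := (φ₁ + φ₂) / 2
  set δ := (φ₁ - φ₂) / 2
  let q : Quat := !₂[Real.cos (θ / 2) * Real.cos σ, Real.sin (θ / 2) * Real.cos δ,
    Real.sin (θ / 2) * Real.sin δ, Real.cos (θ / 2) * Real.sin σ]
  have hq : ‖q‖ = 1 := by
    rw [← sq_eq_sq₀ (norm_nonneg _) zero_le_one, Quat.norm_sq]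
    simp [q]
    linear_combination Real.cos (θ / 2) ^ 2 * Real.sin_sq_add_cos_sq σ +
      Real.sin (θ / 2) ^ 2 * Real.sin_sq_add_cos_sq δ + Real.sin_sq_add_cos_sq (θ / 2)
  refine ⟨⟨q, by simpa using hq⟩, Subtype.ext ?_⟩
  have h1 : φ₁ = σ + δ := by simp only [σ, δ]; ring
  have h2 : φ₂ = σ - δ := by simp only [σ, δ]; ring
  have := coe_ofEuler_eq_quatMatrix (q := q) (σ := σ) (δ := δ) (θ := θ) (by simp [q]) (by simp [q])
    (by simp [q]) (by simp [q])
  rw [h1, h2, this]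
  rfl

/-- The sphere is compact and SO(3) is Hausdorff. Continuity on SO(3) can thus be tested in
quaternion coordinates. -/
theorem isQuotientMap_ofQuat : Topology.IsQuotientMap ofQuat :=
  continuous_ofQuat.isClosedMap.isQuotientMap continuous_ofQuat surjective_ofQuat

end RotationGroup

/-! ### Coefficients from a norming inequality -/

/-- If `|φ v| ≤ K max_i |E v i|` for all `v`, then `φ` is a combination of the functionals
`v ↦ E v i` whose coefficients have `ℓ¹`-norm at most `K`. -/
theorem exists_coeff_of_abs_le {V ι : Type*} [AddCommGroup V] [Module ℝ V] [Fintype ι]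
    (E : V →ₗ[ℝ] (ι → ℝ)) (φ : V →ₗ[ℝ] ℝ) {K : ℝ} (hK : 0 ≤ K)
    (h : ∀ v, |φ v| ≤ K * ‖E v‖) :
    ∃ a : ι → ℝ, (∀ v, ∑ i, a i * E v i = φ v) ∧ ∑ i, |a i| ≤ K := by
  classical
  have hker : LinearMap.ker E ≤ LinearMap.ker φ := by
    intro v hv
    rw [LinearMap.mem_ker] at hv ⊢
    simpa [hv] using h v
  let ψ : LinearMap.range E →ₗ[ℝ] ℝ :=
    (LinearMap.ker E).liftQ φ hker ∘ₗ (E.quotKerEquivRange.symm : _ →ₗ[ℝ] _)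
  have hψ : ∀ v, ψ ⟨E v, LinearMap.mem_range_self E v⟩ = φ v := by
    intro v
    have : E.quotKerEquivRange.symm ⟨E v, LinearMap.mem_range_self E v⟩ =
        (LinearMap.ker E).mkQ v := by
      rw [LinearEquiv.symm_apply_eq]
      rfl
    simp only [ψ, LinearMap.comp_apply, LinearEquiv.coe_coe, this]
    simp
  have hψK : ∀ x, ‖ψ x‖ ≤ K * ‖x‖ := by
    rintro ⟨_, v, rfl⟩
    rw [hψ]
    exact h v
  -- `φ` factors through the range of `E` with norm at most K for the sup norm; Hahn–Banach extends
  -- it to all of ℝ^ι.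
  obtain ⟨g, hg, hgn⟩ := exists_extension_norm_eq (𝕜 := ℝ) _ (ψ.mkContinuous K hψK)
  have hgK : ∀ x, |g x| ≤ K * ‖x‖ := fun x => (g.le_opNorm x).trans (by
    rw [hgn]
    gcongr
    exact ψ.mkContinuous_norm_le hK hψK)
  have hsum : ∀ x : ι → ℝ, g x = ∑ i, g (fun j => if i = j then 1 else 0) * x i := by
    intro x
    rw [← ContinuousLinearMap.coe_coe, LinearMap.pi_apply_eq_sum_univ]
    simp [mul_comm]
  refine ⟨fun i => g (fun j => if i = j then 1 else 0), fun v => ?_, ?_⟩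
  · rw [← hsum]
    have := hg ⟨E v, LinearMap.mem_range_self E v⟩
    rw [this, ← hψ v]
    rfl
  · set a : ι → ℝ := fun i => g (fun j => if i = j then 1 else 0)
    -- Testing on the sign vector, of sup norm at most 1, reads off the ℓ¹-norm.
    have h1 : g (fun i => SignType.sign (a i)) = ∑ i, |a i| := by
      rw [hsum]
      exact Finset.sum_congr rfl fun i _ => self_mul_sign (a i)
    have h2 : ‖(fun i => ((SignType.sign (a i) : SignType) : ℝ))‖ ≤ 1 := by
      rw [pi_norm_le_iff_of_nonneg zero_le_one]
      intro i
      rcases lt_trichotomy (a i) 0 with h | h | h <;> simp [h]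
    rw [← h1]
    exact (le_abs_self _).trans ((hgK _).trans (mul_le_of_le_one_right hK h2))

/-! ### Measurable selection of minimal norm -/

/-- A closed set with nonempty convex slices in a finite-dimensional Euclidean space admits a
measurable selection, namely the elements of minimal norm. -/
theorem exists_measurable_selection {X F : Type*} [TopologicalSpace X] [MeasurableSpace X]
    [OpensMeasurableSpace X] [NormedAddCommGroup F] [InnerProductSpace ℝ F] [ProperSpace F]
    [MeasurableSpace F] [BorelSpace F] {G : Set (X × F)} (hG : IsClosed G)
    (hne : ∀ x, ∃ a, (x, a) ∈ G) (hconv : ∀ x, Convex ℝ {a | (x, a) ∈ G}) :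
    ∃ s : X → F, Measurable s ∧ ∀ x, (x, s x) ∈ G := by
  have hslice : ∀ x, IsClosed {a | (x, a) ∈ G} := fun x =>
    hG.preimage (by fun_prop : Continuous fun a : F => (x, a))
  have hmin : ∀ S : Set F, IsClosed S → S.Nonempty → ∃ a ∈ S, ∀ b ∈ S, ‖a‖ ≤ ‖b‖ := by
    intro S hS hSne
    obtain ⟨a, ha, hd⟩ := hS.exists_infDist_eq_dist hSne 0
    refine ⟨a, ha, fun b hb => ?_⟩
    rw [← dist_zero_left a, ← hd, ← dist_zero_left b]
    exact Metric.infDist_le_dist_of_mem hb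
  choose s hs hsmin using fun x => hmin _ (hslice x) (hne x)
  -- By the parallelogram law, the midpoint of two distinct minimizers in a convex slice would be
  -- strictly shorter.
  have huniq : ∀ x b, (x, b) ∈ G → ‖b‖ ≤ ‖s x‖ → b = s x := by
    intro x b hb hle
    have heq : ‖b‖ = ‖s x‖ := le_antisymm hle (hsmin x b hb)
    have hmid := hsmin x _ (hconv x (hs x) hb (by norm_num : (0 : ℝ) ≤ 1 / 2)
      (by norm_num : (0 : ℝ) ≤ 1 / 2) (by norm_num))
    rw [← smul_add, norm_smul, Real.norm_of_nonneg (by norm_num)] at hmid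
    have hp := parallelogram_law_with_norm ℝ (s x) b
    have : ‖s x - b‖ = 0 := by
      nlinarith [norm_nonneg (s x - b), norm_nonneg (s x), norm_nonneg (s x + b)]
    exact (sub_eq_zero.mp (norm_eq_zero.mp this)).symm
  -- Bounding the norm makes the second factor compact, and projection along a compact factor is
  -- closed.
  have hproj : ∀ D : Set F, IsClosed D → ∀ c : ℝ,
      IsClosed {x | ∃ a ∈ D, (x, a) ∈ G ∧ ‖a‖ ≤ c} := by
    intro D hD c
    have hK : IsCompact (D ∩ Metric.closedBall 0 c) :=
      (isCompact_closedBall 0 c).inter_left hD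
    have := isCompact_iff_compactSpace.mp hK
    have hcl : IsClosed {z : X × ↥(D ∩ Metric.closedBall (0 : F) c) | (z.1, (z.2 : F)) ∈ G} :=
      hG.preimage (by fun_prop)
    convert! isClosedMap_fst_of_compactSpace _ hcl using 1
    ext x
    simp only [Set.mem_ofPred_eq, Set.mem_image, Prod.exists, exists_and_right, exists_eq_right,
      Subtype.exists, Set.mem_inter_iff, mem_closedBall_zero_iff]
    exact ⟨fun ⟨a, h1, h2, h3⟩ => ⟨a, ⟨h1, h3⟩, h2⟩, fun ⟨a, ⟨h1, h3⟩, h2⟩ => ⟨a, h1, h2, h3⟩⟩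
  refine ⟨s, measurable_of_isClosed fun D hD => ?_, hs⟩
  -- s x lies in D exactly when D meets every ball of rational radius c, within the slice, that the
  -- slice itself meets: letting c decrease to ‖s x‖ forces a minimizer into D. Rational radii make
  -- the intersection countable.
  have hpre : s ⁻¹' D = ⋂ c : ℚ, {x | ∃ a ∈ Set.univ, (x, a) ∈ G ∧ ‖a‖ ≤ (c : ℝ)}ᶜ ∪
      {x | ∃ a ∈ D, (x, a) ∈ G ∧ ‖a‖ ≤ (c : ℝ)} := by
    ext x
    simp only [Set.mem_preimage, Set.mem_iInter, Set.mem_union, Set.mem_compl_iff,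
      Set.mem_ofPred_eq, Set.mem_univ, true_and]
    constructor
    · intro hx c
      rw [or_iff_not_imp_left, not_not]
      rintro ⟨a, ha, hac⟩
      exact ⟨s x, hx, hs x, (hsmin x a ha).trans hac⟩
    · intro hx
      have hrat : ∀ c : ℚ, ‖s x‖ ≤ c → ∃ a ∈ D, (x, a) ∈ G ∧ ‖a‖ ≤ (c : ℝ) := fun c hc =>
        (hx c).resolve_left (not_not.mpr ⟨s x, hs x, hc⟩)
      obtain ⟨c₀, hc₀⟩ := exists_rat_gt ‖s x‖
      obtain ⟨a₀, ha₀D, ha₀, -⟩ := hrat c₀ hc₀.le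
      obtain ⟨b, ⟨hbD, hb⟩, hbmin⟩ := hmin (D ∩ {a | (x, a) ∈ G}) (hD.inter (hslice x))
        ⟨a₀, ha₀D, ha₀⟩
      rcases le_or_gt ‖b‖ ‖s x‖ with hle | hlt
      · rwa [← huniq x b hb hle]
      · obtain ⟨c, hc1, hc2⟩ := exists_rat_btwn hlt
        obtain ⟨a, haD, ha, hac⟩ := hrat c hc1.le
        linarith [hbmin a ⟨haD, ha⟩]
  rw [hpre]
  exact MeasurableSet.iInter fun c =>
    (hproj _ isClosed_univ c).measurableSet.compl.union (hproj D hD c).measurableSet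

namespace RotationGroup

/-! ### Polynomials on `SO(3)` along great circles -/

theorem isArcPoly_apply (i : Fin 4) : IsArcPoly 1 (fun q : Quat => q i) :=
  IsArcPoly.linear (EuclideanSpace.proj i : Quat →L[ℝ] ℝ).toLinearMap

theorem isComplexArcPoly_mk (i j : Fin 4) :
    IsComplexArcPoly 1 (fun q : Quat => (⟨q i, -q j⟩ : ℂ)) :=
  ⟨isArcPoly_apply i, by simpa using (isArcPoly_apply j).const_mul (-1)⟩

theorem isComplexArcPoly_conj_mk (i j : Fin 4) :
    IsComplexArcPoly 1 (fun q : Quat => starRingEnd ℂ (⟨q i, -q j⟩ : ℂ)) :=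
  ⟨by simpa using isArcPoly_apply i, by simpa using isArcPoly_apply j⟩

theorem continuous_mk (i j : Fin 4) : Continuous fun q : Quat => (⟨q i, -q j⟩ : ℂ) := by
  have : (fun q : Quat => (⟨q i, -q j⟩ : ℂ)) = fun q : Quat => (q i : ℂ) - (q j : ℂ) * Complex.I := by
    ext q
    apply Complex.ext <;> simp
  rw [this]
  fun_prop

theorem mk_eq_mul_exp {x y r σ : ℝ} (hx : x = r * Real.cos σ) (hy : y = r * Real.sin σ) :
    (⟨x, -y⟩ : ℂ) = r * Complex.exp (-Complex.I * σ) := by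
  have : -Complex.I * σ = ((-σ : ℝ) : ℂ) * Complex.I := by push_cast; ring
  rw [this]
  apply Complex.ext
  · simp [Complex.exp_ofReal_mul_I_re, -Complex.ofReal_neg, hx]
  · simp [Complex.exp_ofReal_mul_I_im, -Complex.ofReal_neg, hy]

/-- In quaternion coordinates, the elements of `Π_L` are continuous and trigonometric polynomials
along great circles, of degree `2 L` in the half angle. -/
theorem exists_lift_of_mem_polynomialSpace {L : ℕ} {p : SO3 → ℂ} (hp : p ∈ polynomialSpace L) :
    ∃ G : Quat → ℂ, Continuous G ∧ IsComplexArcPoly (2 * L) G ∧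
      ∀ q : Metric.sphere (0 : Quat) 1, p (ofQuat q) = G q := by
  induction hp using Submodule.span_induction with
  | mem p hp =>
    obtain ⟨ℓ, k, m, hℓ, hk, hm, rfl⟩ := hp
    obtain ⟨N, c, e₁, e₂, e₃, e₄, he, hD⟩ := exists_wignerDEuler_eq_sum hk hm
    refine ⟨fun q => ∑ j ∈ Finset.range N, c j *
      ((⟨q 0, -q 3⟩ : ℂ) ^ e₁ j * (starRingEnd ℂ (⟨q 0, -q 3⟩ : ℂ)) ^ e₂ j *
      ((⟨q 1, -q 2⟩ : ℂ) ^ e₃ j * (starRingEnd ℂ (⟨q 1, -q 2⟩ : ℂ)) ^ e₄ j)), ?_, ?_, ?_⟩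
    · have h1 := continuous_mk 0 3
      have h2 := continuous_mk 1 2
      have h3 := Complex.continuous_conj.comp h1
      have h4 := Complex.continuous_conj.comp h2
      exact continuous_finsetSum _ fun j _ => continuous_const.mul
        (((h1.pow _).mul (h3.pow _)).mul ((h2.pow _).mul (h4.pow _)))
    -- Passing to half angles doubles all degrees, so 2L - 2ℓ is even and different ℓ share one
    -- parity class.
    · refine IsComplexArcPoly.mono (n := 2 * ℓ) (by omega) ⟨L - ℓ, by omega⟩
        (IsComplexArcPoly.sum _ fun j hj => IsComplexArcPoly.const_mul _ ?_)
      have := (((isComplexArcPoly_mk 0 3).pow (e₁ j)).mul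
        ((isComplexArcPoly_conj_mk 0 3).pow (e₂ j))).mul (((isComplexArcPoly_mk 1 2).pow (e₃ j)).mul
        ((isComplexArcPoly_conj_mk 1 2).pow (e₄ j)))
      simpa only [mul_one, he j hj] using this
    · intro q
      obtain ⟨σ, δ, θ, h0, hπ, hq, q0, q3, q1, q2⟩ := exists_ofEuler_eq_ofQuat q
      rw [hq, wignerD_ofEuler _ _ _ _ _ h0 hπ, hD σ δ θ h0 hπ]
      simp only [mk_eq_mul_exp q0 q3, mk_eq_mul_exp q1 q2]
  | zero => exact ⟨fun _ => 0, continuous_const, IsComplexArcPoly.zero _, fun _ => rfl⟩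
  | add p p' _ _ ih ih' =>
    obtain ⟨G, hc, ha, h⟩ := ih
    obtain ⟨G', hc', ha', h'⟩ := ih'
    exact ⟨_, hc.add hc', ha.add ha', fun q => by simp [h, h']⟩
  | smul a p _ ih =>
    obtain ⟨G, hc, ha, h⟩ := ih
    exact ⟨_, continuous_const.mul hc, ha.const_mul a, fun q => by simp [h]⟩

theorem continuous_of_mem_polynomialSpace {L : ℕ} {p : SO3 → ℂ} (hp : p ∈ polynomialSpace L) :
    Continuous p := by
  obtain ⟨G, hG, -, h⟩ := exists_lift_of_mem_polynomialSpace hp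
  rw [isQuotientMap_ofQuat.continuous_iff]
  exact (hG.comp continuous_subtype_val).congr fun q => (h q).symm

/-! ### The metric in quaternion coordinates -/

theorem rotDist_ofQuat (p q : Metric.sphere (0 : Quat) 1) :
    rotDist (ofQuat p) (ofQuat q) = Real.arccos (2 * (inner ℝ p.1 q.1) ^ 2 - 1) := by
  rw [rotDist, rotationAngle, trace_inv_mul_ofQuat, real_inner_comm]
  congr 1
  ring

theorem rotDist_comm (x y : SO3) : rotDist x y = rotDist y x := by
  obtain ⟨p, rfl⟩ := surjective_ofQuat x
  obtain ⟨q, rfl⟩ := surjective_ofQuat y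
  rw [rotDist_ofQuat, rotDist_ofQuat, real_inner_comm]

theorem rotDist_le_pi (x y : SO3) : rotDist x y ≤ Real.pi := Real.arccos_le_pi _

theorem continuous_rotDist_left (y : SO3) : Continuous fun x => rotDist x y := by
  rw [isQuotientMap_ofQuat.continuous_iff]
  obtain ⟨q, rfl⟩ := surjective_ofQuat y
  have : (fun x => rotDist x (ofQuat q)) ∘ ofQuat =
      fun p => Real.arccos (2 * (inner ℝ p.1 q.1) ^ 2 - 1) := funext fun p => rotDist_ofQuat p q
  rw [this]
  refine Real.continuous_arccos.comp ?_
  fun_prop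

/-- With φ the angle between p and q, the rotation distance is at most 2φ, while the chord 2
sin(φ/2) is at least 2φ/π by Jordan's inequality. -/
theorem rotDist_ofQuat_le (p q : Metric.sphere (0 : Quat) 1) :
    rotDist (ofQuat p) (ofQuat q) ≤ Real.pi * ‖p.1 - q.1‖ := by
  have hp : ‖p.1‖ = 1 := by simp
  have hq : ‖q.1‖ = 1 := by simp
  have hab := abs_le.mp (abs_real_inner_le_norm p.1 q.1)
  rw [hp, hq, mul_one] at hab
  set φ := Real.arccos (inner ℝ p.1 q.1) with hφ
  have hφ0 : 0 ≤ φ := Real.arccos_nonneg _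
  have hφπ : φ ≤ Real.pi := Real.arccos_le_pi _
  have hcos : inner ℝ p.1 q.1 = Real.cos φ := (Real.cos_arccos hab.1 hab.2).symm
  have h1 : rotDist (ofQuat p) (ofQuat q) ≤ 2 * φ := by
    rw [rotDist_ofQuat, hcos, ← Real.cos_two_mul]
    rcases le_total (2 * φ) Real.pi with h | h
    · rw [Real.arccos_cos (by linarith) h]
    · exact (Real.arccos_le_pi _).trans h
  have h2 : ‖p.1 - q.1‖ = 2 * Real.sin (φ / 2) := by
    have hs : 0 ≤ Real.sin (φ / 2) :=
      Real.sin_nonneg_of_nonneg_of_le_pi (by linarith) (by linarith)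
    rw [← sq_eq_sq₀ (norm_nonneg _) (by positivity), norm_sub_sq_of_unit hp hq, hcos,
      show Real.cos φ = Real.cos (2 * (φ / 2)) by congr 1; ring, Real.cos_two_mul']
    linear_combination -2 * Real.sin_sq_add_cos_sq (φ / 2)
  have h3 := Real.mul_le_sin (x := φ / 2) (by linarith) (by linarith)
  calc rotDist (ofQuat p) (ofQuat q) ≤ 2 * φ := h1
    _ = Real.pi * (2 * (2 / Real.pi * (φ / 2))) := by field_simp
    _ ≤ _ := by rw [h2]; gcongr

theorem ofQuat_neg (p : Metric.sphere (0 : Quat) 1) : ofQuat (-p) = ofQuat p := by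
  apply Subtype.ext
  ext i j
  fin_cases i <;> fin_cases j <;> simp [ofQuat, quatMatrix]

/-- One of ±p makes an angle φ ≤ π/2 with q; for it the rotation distance is exactly 2φ, and the
chord is at most φ. -/
theorem exists_ofQuat_eq_norm_sub_le {p q : Metric.sphere (0 : Quat) 1} {h : ℝ}
    (hpq : rotDist (ofQuat p) (ofQuat q) ≤ h) :
    ∃ p' : Metric.sphere (0 : Quat) 1, ofQuat p' = ofQuat p ∧ ‖p'.1 - q.1‖ ≤ h / 2 := by
  wlog hpos : 0 ≤ inner ℝ p.1 q.1 generalizing p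
  · rw [← ofQuat_neg] at hpq
    obtain ⟨p', hp', hle⟩ := this hpq (by simpa using (not_le.mp hpos).le)
    exact ⟨p', by rw [hp', ofQuat_neg], hle⟩
  refine ⟨p, rfl, ?_⟩
  have hp : ‖p.1‖ = 1 := by simp
  have hq : ‖q.1‖ = 1 := by simp
  have hab := abs_le.mp (abs_real_inner_le_norm p.1 q.1)
  rw [hp, hq, mul_one] at hab
  set φ := Real.arccos (inner ℝ p.1 q.1) with hφ
  have hφ0 : 0 ≤ φ := Real.arccos_nonneg _
  have hφπ : φ ≤ Real.pi / 2 := Real.arccos_le_pi_div_two.mpr hpos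
  have hcos : inner ℝ p.1 q.1 = Real.cos φ := (Real.cos_arccos hab.1 hab.2).symm
  rw [rotDist_ofQuat, hcos, ← Real.cos_two_mul, Real.arccos_cos (by linarith) (by linarith)] at hpq
  have h1 : ‖p.1 - q.1‖ ≤ φ := by
    refine le_of_sq_le_sq ?_ hφ0
    rw [norm_sub_sq_of_unit hp hq, hcos]
    linarith [Real.one_sub_sq_div_two_le_cos (x := φ)]
  linarith

theorem exists_rotDist_le_fillDistance {Ξ : Finset SO3} (hΞ : Ξ.Nonempty) (y : SO3) :
    ∃ ξ ∈ Ξ, rotDist ξ y ≤ fillDistance Ξ := by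
  have : Nonempty Ξ := hΞ.to_subtype
  obtain ⟨ξ, hξ⟩ := exists_eq_ciInf_of_finite (f := fun ξ : Ξ => rotDist ξ y)
  refine ⟨ξ, ξ.2, ?_⟩
  rw [hξ]
  refine le_ciSup (f := fun y : SO3 => ⨅ ξ : Ξ, rotDist ξ y) ⟨Real.pi, ?_⟩ y
  rintro _ ⟨z, rfl⟩
  exact (ciInf_le (Set.finite_range _).bddBelow ξ).trans (rotDist_le_pi _ _)

/-! ### The norming inequality and the kernel -/

theorem exists_orthogonal_unit (α : Metric.sphere (0 : Quat) 1) :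
    ∃ e : Quat, ‖e‖ = 1 ∧ inner ℝ α.1 e = 0 := by
  -- The quaternion product i α.
  refine ⟨!₂[-α.1 1, α.1 0, -α.1 3, α.1 2], ?_, ?_⟩
  · have h : ‖α.1‖ ^ 2 = 1 := by simp
    rw [Quat.norm_sq] at h
    rw [← sq_eq_sq₀ (norm_nonneg _) zero_le_one, Quat.norm_sq]
    simp
    linarith
  · rw [Quat.inner_eq]
    simp
    ring

/-- The cap inequality transported to SO(3); it is the norming hypothesis for the duality argument.
-/
theorem exists_center_abs_re_le {L : ℕ} (hL : 1 ≤ L) {Ξ : Finset SO3} (hΞ : Ξ.Nonempty)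
    (hh : fillDistance Ξ ≤ Real.pi / (220000 * (L : ℝ) ^ 2)) {p : SO3 → ℂ}
    (hp : p ∈ polynomialSpace L) (α : SO3) :
    ∃ ξ ∈ Ξ, rotDist α ξ ≤ 220000 * (L : ℝ) ^ 2 * fillDistance Ξ ∧
      |(p α).re| ≤ 2 * |(p ξ).re| := by
  obtain ⟨α, rfl⟩ := surjective_ofQuat α
  have hL1 : (1 : ℝ) ≤ L := by exact_mod_cast hL
  have hnet : ∀ q : Metric.sphere (0 : Quat) 1, ∃ ξ : Metric.sphere (0 : Quat) 1, ofQuat ξ ∈ Ξ ∧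
      ‖ξ.1 - q.1‖ ≤ fillDistance Ξ / 2 := by
    intro q
    obtain ⟨x, hx, hd⟩ := exists_rotDist_le_fillDistance hΞ (ofQuat q)
    obtain ⟨ξ, rfl⟩ := surjective_ofQuat x
    obtain ⟨ξ', he, hle⟩ := exists_ofQuat_eq_norm_sub_le hd
    exact ⟨ξ', by rwa [he], hle⟩
  set h := fillDistance Ξ
  have h0 : 0 ≤ h := by
    obtain ⟨ξ, -, hle⟩ := hnet α
    linarith [norm_nonneg (ξ.1 - α.1)]
  have hρ : 220000 * (L : ℝ) ^ 2 * h ≤ Real.pi := by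
    rw [le_div_iff₀ (by positivity)] at hh; linarith
  rcases h0.eq_or_lt with h0 | h0
  -- The cap argument needs a positive mesh; for h = 0 the point is itself a center.
  · obtain ⟨ξ, hξ, hle⟩ := hnet α
    rw [← h0, zero_div] at hle
    have : ξ = α := Subtype.ext (sub_eq_zero.mp (norm_eq_zero.mp (hle.antisymm (norm_nonneg _))))
    subst this
    refine ⟨_, hξ, ?_, by linarith [abs_nonneg (p (ofQuat ξ)).re]⟩
    refine (rotDist_ofQuat_le _ _).trans ?_
    rw [sub_self, norm_zero, mul_zero]
    positivity
  obtain ⟨G, hc, ha, hG⟩ := exists_lift_of_mem_polynomialSpace hp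
  obtain ⟨e, he, hαe⟩ := exists_orthogonal_unit α
  have hn : 1 ≤ 2 * L := by omega
  -- With n = 2L and η = h/2 the choice r = ρ/10 gives equality in 11000 n² η ≤ r. Moreover ρ ≤ π <
  -- 4 gives r ≤ 1/2, and passing back to rotation distances costs a factor π < 4 < 10.
  obtain ⟨ξ, ⟨ξ', hξ', rfl⟩, hξ1, hξα, hle⟩ := ha.1.exists_abs_le_two_mul hn
    (Complex.continuous_re.comp hc).continuousOn (by simp : ‖α.1‖ = 1) he hαe
    (r := 220000 * (L : ℝ) ^ 2 * h / 10) (η := h / 2) (by linarith [Real.pi_lt_four])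
    (by linarith) (by push_cast; linarith)
    (N := Subtype.val '' {ξ : Metric.sphere (0 : Quat) 1 | ofQuat ξ ∈ Ξ}) (by
      intro q hq
      obtain ⟨ξ, hξ, hle⟩ := hnet ⟨q, by simpa using hq⟩
      exact ⟨ξ, ⟨ξ, hξ, rfl⟩, by simp, hle⟩)
  refine ⟨ofQuat ξ', hξ', ?_, by rwa [hG, hG]⟩
  rw [rotDist_comm]
  calc _ ≤ Real.pi * ‖ξ'.1 - α.1‖ := rotDist_ofQuat_le _ _
    _ ≤ 4 * (220000 * (L : ℝ) ^ 2 * h / 10) := by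
        gcongr
        exact Real.pi_lt_four.le
    _ ≤ _ := by linarith [mul_nonneg (sq_nonneg (L : ℝ)) h0.le]

theorem exists_coeff {L : ℕ} (hL : 1 ≤ L) {Ξ : Finset SO3} (hΞ : Ξ.Nonempty)
    (hh : fillDistance Ξ ≤ Real.pi / (220000 * (L : ℝ) ^ 2)) (α : SO3) :
    ∃ a : Ξ → ℝ, (∀ ξ : Ξ, rotDist α ξ ≤ 220000 * (L : ℝ) ^ 2 * fillDistance Ξ ∨ a ξ = 0) ∧
      (∀ p ∈ polynomialSpace L, ∑ ξ : Ξ, (a ξ : ℂ) * p ξ = p α) ∧ ∑ ξ : Ξ, |a ξ| ≤ 2 := by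
  classical
  set ρ := 220000 * (L : ℝ) ^ 2 * fillDistance Ξ
  -- Distant centers are masked by zero, so the sup norm sees only centers within ρ of α.
  let E : polynomialSpace L →ₗ[ℝ] (Ξ → ℝ) :=
    { toFun := fun p ξ => if rotDist α ξ ≤ ρ then (p.1 ξ).re else 0
      map_add' := fun p p' => by ext ξ; by_cases h : rotDist α ξ ≤ ρ <;> simp [h]
      map_smul' := fun c p => by ext ξ; by_cases h : rotDist α ξ ≤ ρ <;> simp [h] }
  let φ : polynomialSpace L →ₗ[ℝ] ℝ :=
    { toFun := fun p => (p.1 α).re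
      map_add' := fun p p' => by simp
      map_smul' := fun c p => by simp }
  obtain ⟨a, ha, hsum⟩ := exists_coeff_of_abs_le E φ zero_le_two (by
    intro p
    obtain ⟨ξ, hξ, hd, hle⟩ := exists_center_abs_re_le hL hΞ hh p.2 α
    have h1 : E p ⟨ξ, hξ⟩ = (p.1 ξ).re := if_pos hd
    have h2 := norm_le_pi_norm (E p) ⟨ξ, hξ⟩
    rw [h1, Real.norm_eq_abs] at h2
    exact hle.trans (by linarith))
  have hre : ∀ p ∈ polynomialSpace L,
      ∑ ξ : Ξ, (if rotDist α ξ ≤ ρ then a ξ else 0) * (p ξ).re = (p α).re := by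
    intro p hp
    refine Eq.trans (Finset.sum_congr rfl fun ξ _ => ?_) (ha ⟨p, hp⟩)
    simp [E]
  refine ⟨fun ξ => if rotDist α ξ ≤ ρ then a ξ else 0, fun ξ => ?_, fun p hp => ?_, ?_⟩
  · by_cases h : rotDist α ξ ≤ ρ <;> simp [h]
  -- Im p is the real part of -i p, which is again in Π_L.
  · have him := hre _ (Submodule.smul_mem _ (-Complex.I) hp)
    apply Complex.ext
    · rw [Complex.re_sum, ← hre p hp]
      simp only [Complex.re_ofReal_mul]
    · simp only [Pi.smul_apply, smul_eq_mul, neg_mul, Complex.neg_re, Complex.I_mul_re,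
        neg_neg] at him
      rw [Complex.im_sum, ← him]
      simp only [Complex.im_ofReal_mul]
  · refine le_trans (Finset.sum_le_sum fun ξ _ => ?_) hsum
    beta_reduce
    split_ifs <;> simp

end RotationGroup

/-! ### Measurable choice of the coefficients -/

theorem lemma4p2 :
    ∃ C : ℝ, 0 < C ∧ ∀ (L : ℕ), 1 ≤ L → ∀ (Ξ : Finset RotationGroup.SO3), Ξ.Nonempty →
      RotationGroup.fillDistance Ξ ≤ Real.pi / (C * (L : ℝ) ^ 2) →
      ∃ a : Ξ × RotationGroup.SO3 → ℝ,
        RotationGroup.CoefficientKernelConditions Ξ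
          (C * (L : ℝ) ^ 2 * RotationGroup.fillDistance Ξ) L 2 a := by
  refine ⟨220000, by norm_num, fun L hL Ξ hΞ hh => ?_⟩
  set ρ := 220000 * (L : ℝ) ^ 2 * RotationGroup.fillDistance Ξ with hρ
  -- The support condition is stated as an alternative of two closed conditions, so that G is
  -- closed. The Euclidean norm on the coefficients serves the selection of minimal norm.
  let G : Set (RotationGroup.SO3 × EuclideanSpace ℝ Ξ) :=
    {z | (∀ ξ : Ξ, RotationGroup.rotDist z.1 ξ ≤ ρ ∨ z.2 ξ = 0) ∧
      (∀ p ∈ RotationGroup.polynomialSpace L, ∑ ξ : Ξ, (z.2 ξ : ℂ) * p ξ = p z.1) ∧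
      ∑ ξ : Ξ, |z.2 ξ| ≤ 2}
  have hG : IsClosed G := by
    have hd := fun ξ : Ξ =>
      (RotationGroup.continuous_rotDist_left (ξ : RotationGroup.SO3)).comp
        (continuous_fst (X := RotationGroup.SO3) (Y := EuclideanSpace ℝ Ξ))
    simp only [G, Set.ofPred_and, Set.ofPred_forall, Set.ofPred_or]
    refine IsClosed.inter (isClosed_iInter fun ξ => ?_) (IsClosed.inter
      (isClosed_iInter fun p => isClosed_iInter fun hp => ?_) ?_)
    · exact (isClosed_le (hd ξ) continuous_const).union
        (isClosed_eq (by fun_prop) continuous_const)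
    · exact isClosed_eq (by fun_prop)
        ((RotationGroup.continuous_of_mem_polynomialSpace hp).comp continuous_fst)
    · exact isClosed_le (by fun_prop) continuous_const
  obtain ⟨s, hs, hsG⟩ := exists_measurable_selection hG
    (fun α => by
      obtain ⟨a, h1, h2, h3⟩ := RotationGroup.exists_coeff hL hΞ hh α
      exact ⟨WithLp.toLp 2 a, h1, h2, h3⟩)
    (fun α => by
      rintro a ⟨a1, a2, a3⟩ b ⟨b1, b2, b3⟩ x y hx hy hxy
      refine ⟨fun ξ => ?_, fun p hp => ?_, ?_⟩
      · rcases a1 ξ with h | h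
        · exact Or.inl h
        · rcases b1 ξ with h' | h'
          · exact Or.inl h'
          · exact Or.inr (by simp at h h'; simp [h, h'])
      · have hxy' : (x : ℂ) + y = 1 := by exact_mod_cast hxy
        have ea := a2 p hp
        have eb := b2 p hp
        calc ∑ ξ : Ξ, (((x • a + y • b : EuclideanSpace ℝ Ξ) ξ : ℝ) : ℂ) * p ξ
            = x * ∑ ξ : Ξ, (a ξ : ℂ) * p ξ + y * ∑ ξ : Ξ, (b ξ : ℂ) * p ξ := by
              rw [Finset.mul_sum, Finset.mul_sum, ← Finset.sum_add_distrib]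
              refine Finset.sum_congr rfl fun ξ _ => ?_
              simp
              ring
          _ = p α := by rw [ea, eb, ← add_mul, hxy', one_mul]
      · calc ∑ ξ : Ξ, |(x • a + y • b : EuclideanSpace ℝ Ξ) ξ|
            ≤ ∑ ξ : Ξ, (x * |a ξ| + y * |b ξ|) := Finset.sum_le_sum fun ξ _ => by
              refine (abs_add_le _ _).trans (le_of_eq ?_)
              simp [abs_mul, abs_of_nonneg hx, abs_of_nonneg hy]
          _ = x * ∑ ξ : Ξ, |a ξ| + y * ∑ ξ : Ξ, |b ξ| := by
              rw [Finset.mul_sum, Finset.mul_sum, ← Finset.sum_add_distrib]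
          _ ≤ x * 2 + y * 2 := by gcongr
          _ = 2 := by rw [← add_mul, hxy, one_mul])
  refine ⟨fun z => s z.2 z.1, ?_, ?_, ?_, one_le_two, ?_⟩
  -- Ξ is finite, so joint measurability reduces to each coordinate of the selection.
  · refine measurable_from_prod_countable_right fun ξ => ?_
    exact (EuclideanSpace.proj ξ : EuclideanSpace ℝ Ξ →L[ℝ] ℝ).continuous.measurable.comp hs
  · exact fun ξ α h => ((hsG α).1 ξ).resolve_left (not_le.mpr h)
  · exact fun p hp α => (hsG α).2.1 p hp
  · exact fun α => (hsG α).2.2
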